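/- Let $\mathcal H$ be a finite-dimensional complex Hilbert space and let $V$ be a multiplicative unitary on $\mathcal H$, i.e. a unitary operator $V\in\mathcal L(\mathcal H\otimes\mathcal H)$ with $V_{12}V_{13}V_{23}=V_{23}V_{12}$ in $\mathcal L(\mathcal H\otimes\mathcal H\otimes\mathcal H)$. Assume that $V$ has multiplicity $1$: the space of fixed vectors $\{\xi\in\mathcal H : V(\xi\otimes\eta)=\xi\otimes\eta \text{ for all }\eta\in\mathcal H\}$ is one-dimensional. Let $S=\{(\omega\otimes\mathrm{id})(V) : \omega\in\mathcal L(\mathcal H)^*\}\subset\mathcal L(\mathcal H)$ be the associated unital algebra, with the coproduct $\delta(x)=V(x\otimes 1)V^*\in S\otimes S\subset\mathcal L(\mathcal H\otimes\mathcal H)$ for $x\in S$. Let $B\subset S$ be a subalgebra containing the unit which is a left coideal subalgebra, i.e. $\delta(B)\subset S\otimes B$, or a right coideal subalgebra, i.e. $\delta(B)\subset B\otimes S$. Then $S$ is a free left $B$-module and a free right $B$-module (for multiplication in $S$). -/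

import Mathlib

open scoped TensorProduct

namespace MultUnitary

section Legs

variable {M N : Type*} [AddCommGroup M] [Module ℂ M] [FiniteDimensional ℂ M]
  [AddCommGroup N] [Module ℂ N] [FiniteDimensional ℂ N]

/-- The slice map `(ω ⊗ id) : End (M ⊗ N) = End M ⊗ End N → End N` of a linear form `ω` on
`End M`. -/
noncomputable def slice (ω : Module.Dual ℂ (Module.End ℂ M)) :
    Module.End ℂ (M ⊗[ℂ] N) →ₗ[ℂ] Module.End ℂ N :=
  (TensorProduct.lid ℂ (Module.End ℂ N)).toLinearMap ∘ₗ
    LinearMap.rTensor (Module.End ℂ N) ω ∘ₗ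
      (homTensorHomEquiv ℂ M N M N).symm.toLinearMap

theorem slice_map (ω : Module.Dual ℂ (Module.End ℂ M)) (a : Module.End ℂ M)
    (b : Module.End ℂ N) : slice ω (TensorProduct.map a b) = ω a • b := by
  have h : (homTensorHomEquiv ℂ M N M N).symm (TensorProduct.map a b) = a ⊗ₜ[ℂ] b := by
    rw [LinearEquiv.symm_apply_eq, homTensorHomEquiv_apply,
      TensorProduct.homTensorHomMap_apply]
  simp [slice, h]

/-- Every operator on `M ⊗ N` is a sum of elementary tensors `a ⊗ b`. -/
theorem end_induction {p : Module.End ℂ (M ⊗[ℂ] N) → Prop} (h0 : p 0)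
    (hm : ∀ a b, p (TensorProduct.map a b)) (ha : ∀ S T, p S → p T → p (S + T)) (T) : p T := by
  obtain ⟨t, rfl⟩ := (homTensorHomEquiv ℂ M N M N).surjective T
  induction t with
  | zero => simpa using h0
  | tmul a b =>
    simpa only [homTensorHomEquiv_apply, TensorProduct.homTensorHomMap_apply] using hm a b
  | add x y hx hy => rw [map_add]; exact ha _ _ hx hy

variable {H : Type*} [AddCommGroup H] [Module ℂ H]

/-- `T₁₂ = T ⊗ 1` on `H ⊗ H ⊗ H`. -/
noncomputable def leg12 (T : Module.End ℂ (H ⊗[ℂ] H)) : Module.End ℂ ((H ⊗[ℂ] H) ⊗[ℂ] H) :=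
  LinearMap.rTensor H T

/-- `T₂₃ = 1 ⊗ T` on `H ⊗ H ⊗ H`. -/
noncomputable def leg23 (T : Module.End ℂ (H ⊗[ℂ] H)) : Module.End ℂ ((H ⊗[ℂ] H) ⊗[ℂ] H) :=
  (TensorProduct.assoc ℂ H H H).symm.toLinearMap ∘ₗ LinearMap.lTensor H T ∘ₗ
    (TensorProduct.assoc ℂ H H H).toLinearMap

/-- `T₁₃`: the operator `T` acting on the first and third factors of `H ⊗ H ⊗ H`. -/
noncomputable def leg13 (T : Module.End ℂ (H ⊗[ℂ] H)) : Module.End ℂ ((H ⊗[ℂ] H) ⊗[ℂ] H) :=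
  (TensorProduct.rightComm ℂ H H H).toLinearMap ∘ₗ LinearMap.rTensor H T ∘ₗ
    (TensorProduct.rightComm ℂ H H H).toLinearMap

theorem leg23_map (a b : Module.End ℂ H) :
    leg23 (TensorProduct.map a b) = TensorProduct.map (TensorProduct.map 1 a) b := by
  ext x y z; simp [leg23]

theorem leg13_map (a b : Module.End ℂ H) :
    leg13 (TensorProduct.map a b) = TensorProduct.map (TensorProduct.map a 1) b := by
  ext x y z; simp [leg13]

theorem leg23_add (S T : Module.End ℂ (H ⊗[ℂ] H)) : leg23 (S + T) = leg23 S + leg23 T := by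
  ext x y z; simp [leg23]

theorem leg13_add (S T : Module.End ℂ (H ⊗[ℂ] H)) : leg13 (S + T) = leg13 S + leg13 T := by
  ext x y z; simp [leg13]

theorem leg23_zero : leg23 (0 : Module.End ℂ (H ⊗[ℂ] H)) = 0 := by
  ext x y z; simp [leg23]

theorem leg13_zero : leg13 (0 : Module.End ℂ (H ⊗[ℂ] H)) = 0 := by
  ext x y z; simp [leg13]

variable [FiniteDimensional ℂ H]

/-- `(ω ⊗ ω' ⊗ id)(A₁₃ B₂₃) = (ω ⊗ id)(A) (ω' ⊗ id)(B)`. -/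
theorem slice_leg13_mul_leg23 (ω ω' : Module.Dual ℂ (Module.End ℂ H))
    (A B : Module.End ℂ (H ⊗[ℂ] H)) :
    slice (ω' ∘ₗ slice ω) (leg13 A * leg23 B) = slice ω A * slice ω' B := by
  refine end_induction (p := fun A => slice (ω' ∘ₗ slice ω) (leg13 A * leg23 B)
    = slice ω A * slice ω' B) ?_ (fun a a' => ?_) (fun S T hS hT => ?_) A
  · simp [leg13_zero]
  · refine end_induction (p := fun B =>
      slice (ω' ∘ₗ slice ω) (leg13 (TensorProduct.map a a') * leg23 B)
      = slice ω (TensorProduct.map a a') * slice ω' B) ?_ (fun b b' => ?_)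
      (fun S T hS hT => ?_) B
    · simp [leg23_zero]
    · rw [leg13_map, leg23_map, ← TensorProduct.map_mul, ← TensorProduct.map_mul, slice_map,
        slice_map, slice_map]
      simp [slice_map, smul_smul, mul_comm]
    · simp only [leg23_add, mul_add, map_add, hS, hT]
  · simp only [leg13_add, add_mul, map_add, hS, hT]

/-- `(Ω ⊗ id)(P₁₂ T₂₃ Q₁₂) = (ψ ⊗ id)(T)` for `ψ(x) = Ω(P (1 ⊗ x) Q)`. -/
theorem slice_conj (Ω : Module.Dual ℂ (Module.End ℂ (H ⊗[ℂ] H)))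
    (P Q T : Module.End ℂ (H ⊗[ℂ] H)) :
    slice Ω (leg12 P * leg23 T * leg12 Q) =
      slice (Ω ∘ₗ LinearMap.mulLeft ℂ P ∘ₗ LinearMap.mulRight ℂ Q ∘ₗ
        TensorProduct.mapBilinear (RingHom.id ℂ) H H H H 1) T := by
  refine end_induction (p := fun T => slice Ω (leg12 P * leg23 T * leg12 Q) =
      slice (Ω ∘ₗ LinearMap.mulLeft ℂ P ∘ₗ LinearMap.mulRight ℂ Q ∘ₗ
        TensorProduct.mapBilinear (RingHom.id ℂ) H H H H 1) T) ?_ (fun a b => ?_)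
      (fun S T hS hT => ?_) T
  · simp [leg23_zero]
  · have h : ∀ R : Module.End ℂ (H ⊗[ℂ] H), leg12 R = TensorProduct.map R 1 := fun _ => rfl
    rw [leg23_map, h, h, ← TensorProduct.map_mul, ← TensorProduct.map_mul, slice_map, slice_map]
    simp [mul_assoc]
  · simp only [leg23_add, mul_add, add_mul, map_add, hS, hT]

/-- For `ω(T) = f(T e)`, one has `(ω ⊗ id)(T) η = (f ⊗ id)(T (e ⊗ η))`. -/
theorem slice_vector (f : Module.Dual ℂ H) (e η : H) (T : Module.End ℂ (H ⊗[ℂ] H)) :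
    slice (f ∘ₗ LinearMap.applyₗ e) T η =
      TensorProduct.lid ℂ H (LinearMap.rTensor H f (T (e ⊗ₜ[ℂ] η))) := by
  refine end_induction (p := fun T => slice (f ∘ₗ LinearMap.applyₗ e) T η =
      TensorProduct.lid ℂ H (LinearMap.rTensor H f (T (e ⊗ₜ[ℂ] η)))) ?_ (fun a b => ?_)
      (fun S T hS hT => ?_) T
  · simp
  · simp [slice_map]
  · simp only [LinearMap.add_apply, map_add, hS, hT]

end Legs

end MultUnitary

/-- A multiplicative unitary on a finite-dimensional Hilbert space `H`: a unitary operator `V`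
on the Hilbert space `H ⊗ H` such that `V₁₂ V₁₃ V₂₃ = V₂₃ V₁₂`. -/
structure MultiplicativeUnitary (H : Type*) [NormedAddCommGroup H] [InnerProductSpace ℂ H] where
  /-- The underlying unitary operator. -/
  toUnitary : (H ⊗[ℂ] H) ≃ₗᵢ[ℂ] (H ⊗[ℂ] H)
  pentagon : MultUnitary.leg12 (toUnitary.toLinearEquiv : Module.End ℂ (H ⊗[ℂ] H)) *
      MultUnitary.leg13 (toUnitary.toLinearEquiv : Module.End ℂ (H ⊗[ℂ] H)) *
      MultUnitary.leg23 (toUnitary.toLinearEquiv : Module.End ℂ (H ⊗[ℂ] H)) =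
    MultUnitary.leg23 (toUnitary.toLinearEquiv : Module.End ℂ (H ⊗[ℂ] H)) *
      MultUnitary.leg12 (toUnitary.toLinearEquiv : Module.End ℂ (H ⊗[ℂ] H))

namespace MultiplicativeUnitary

variable {H : Type*} [NormedAddCommGroup H] [InnerProductSpace ℂ H]

/-- `V` as a linear operator on `H ⊗ H`. -/
noncomputable def op (V : MultiplicativeUnitary H) : Module.End ℂ (H ⊗[ℂ] H) :=
  (V.toUnitary.toLinearEquiv : (H ⊗[ℂ] H) →ₗ[ℂ] (H ⊗[ℂ] H))

/-- `V⋆ = V⁻¹` as a linear operator on `H ⊗ H`. -/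
noncomputable def opInv (V : MultiplicativeUnitary H) : Module.End ℂ (H ⊗[ℂ] H) :=
  (V.toUnitary.symm.toLinearEquiv : (H ⊗[ℂ] H) →ₗ[ℂ] (H ⊗[ℂ] H))

theorem opInv_mul_op (V : MultiplicativeUnitary H) : V.opInv * V.op = 1 := by
  apply LinearMap.ext; intro x; simp [op, opInv]

theorem op_mul_opInv (V : MultiplicativeUnitary H) : V.op * V.opInv = 1 := by
  apply LinearMap.ext; intro x; simp [op, opInv]

/-- The space of fixed vectors of `V`: those `ξ` with `V (ξ ⊗ η) = ξ ⊗ η` for all `η`. -/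
def fixedVectors (V : MultiplicativeUnitary H) : Submodule ℂ H where
  carrier := {ξ | ∀ η : H, V.op (ξ ⊗ₜ[ℂ] η) = ξ ⊗ₜ[ℂ] η}
  zero_mem' := fun η => by simp
  add_mem' := fun {a b} ha hb η => by
    rw [TensorProduct.add_tmul, map_add, ha η, hb η]
  smul_mem' := fun c a ha η => by
    rw [← TensorProduct.smul_tmul', map_smul, ha η]

/-- The multiplicity of `V`: the dimension of the space of fixed vectors. -/
noncomputable def multiplicity (V : MultiplicativeUnitary H) : ℕ :=
  Module.finrank ℂ V.fixedVectors

variable [FiniteDimensional ℂ H]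

/-- `L(ω) = (ω ⊗ id)(V)`. -/
noncomputable def L (V : MultiplicativeUnitary H) (ω : Module.Dual ℂ (Module.End ℂ H)) :
    Module.End ℂ H :=
  MultUnitary.slice ω V.op

theorem L_mul_L (V : MultiplicativeUnitary H) (ω ω' : Module.Dual ℂ (Module.End ℂ H)) :
    ∃ ψ, V.L ω * V.L ω' = V.L ψ := by
  have h12 : MultUnitary.leg12 V.opInv * MultUnitary.leg12 V.op = 1 := by
    have h := congrArg (LinearMap.rTensor H) V.opInv_mul_op
    rw [LinearMap.rTensor_mul] at h
    exact h.trans (LinearMap.rTensor_id H (H ⊗[ℂ] H))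
  have h : MultUnitary.leg13 V.op * MultUnitary.leg23 V.op =
      MultUnitary.leg12 V.opInv * MultUnitary.leg23 V.op * MultUnitary.leg12 V.op := by
    have hp : MultUnitary.leg12 V.op * MultUnitary.leg13 V.op * MultUnitary.leg23 V.op =
      MultUnitary.leg23 V.op * MultUnitary.leg12 V.op := V.pentagon
    rw [mul_assoc, ← hp, ← mul_assoc, ← mul_assoc, h12, one_mul]
  exact ⟨_, (MultUnitary.slice_leg13_mul_leg23 ω ω' V.op V.op).symm.trans
    ((congrArg _ h).trans (MultUnitary.slice_conj _ V.opInv V.op V.op))⟩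

theorem exists_L_eq_one (V : MultiplicativeUnitary H) (hV : V.multiplicity = 1) :
    ∃ ω, V.L ω = 1 := by
  have hne : V.fixedVectors ≠ ⊥ := by
    intro h
    rw [multiplicity, h, finrank_bot] at hV
    exact zero_ne_one hV
  obtain ⟨e, he, he0⟩ := Submodule.exists_mem_ne_zero_of_ne_bot hne
  obtain ⟨f, hf⟩ : ∃ f : Module.Dual ℂ H, f e = 1 := by
    refine ⟨(inner ℂ e e)⁻¹ • (innerSL ℂ e).toLinearMap, ?_⟩
    simp [he0]
  refine ⟨f ∘ₗ LinearMap.applyₗ e, LinearMap.ext fun η => ?_⟩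
  rw [L, MultUnitary.slice_vector, he η]
  simp [hf]

/-- The algebra `S = {L(ω) : ω ∈ End(H)*}` of a multiplicative unitary of multiplicity `1`. -/
noncomputable def S (V : MultiplicativeUnitary H) (hV : V.multiplicity = 1) :
    Subalgebra ℂ (Module.End ℂ H) where
  carrier := {x | ∃ ω : Module.Dual ℂ (Module.End ℂ H), V.L ω = x}
  mul_mem' := by
    rintro _ _ ⟨ω, rfl⟩ ⟨ω', rfl⟩
    obtain ⟨ψ, h⟩ := V.L_mul_L ω ω'
    exact ⟨ψ, h.symm⟩
  add_mem' := by
    rintro _ _ ⟨ω, rfl⟩ ⟨ω', rfl⟩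
    exact ⟨ω + ω', by simp [L, MultUnitary.slice, LinearMap.rTensor_add]⟩
  algebraMap_mem' := fun r => by
    obtain ⟨ω, h⟩ := V.exists_L_eq_one hV
    exact ⟨r • ω, by
      rw [Algebra.algebraMap_eq_smul_one, ← h]
      simp [L, MultUnitary.slice, LinearMap.rTensor_smul]⟩

/-- The coproduct `δ(x) = V (x ⊗ 1) V⋆`, with values in `End (H ⊗ H) = End H ⊗ End H`. -/
noncomputable def comul (V : MultiplicativeUnitary H) (x : Module.End ℂ H) :
    Module.End ℂ (H ⊗[ℂ] H) :=
  V.op * TensorProduct.map x 1 * V.opInv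

/-- A (unital) subalgebra `B` of `S` is a right coideal subalgebra if `δ(B) ⊆ B ⊗ S`, where
`B ⊗ S` is regarded as a subspace of `End (H ⊗ H) = End H ⊗ End H`. -/
def IsRightCoideal (V : MultiplicativeUnitary H) (hV : V.multiplicity = 1)
    (B : Subalgebra ℂ (V.S hV)) : Prop :=
  ∀ x ∈ B, V.comul (x : Module.End ℂ H) ∈ Submodule.span ℂ
    {T : Module.End ℂ (H ⊗[ℂ] H) | ∃ b ∈ B, ∃ s : V.S hV,
      T = TensorProduct.map (b : Module.End ℂ H) (s : Module.End ℂ H)}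

/-- A (unital) subalgebra `B` of `S` is a left coideal subalgebra if `δ(B) ⊆ S ⊗ B`, where
`S ⊗ B` is regarded as a subspace of `End (H ⊗ H) = End H ⊗ End H`. -/
def IsLeftCoideal (V : MultiplicativeUnitary H) (hV : V.multiplicity = 1)
    (B : Subalgebra ℂ (V.S hV)) : Prop :=
  ∀ x ∈ B, V.comul (x : Module.End ℂ H) ∈ Submodule.span ℂ
    {T : Module.End ℂ (H ⊗[ℂ] H) | ∃ s : V.S hV, ∃ b ∈ B,
      T = TensorProduct.map (s : Module.End ℂ H) (b : Module.End ℂ H)}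

end MultiplicativeUnitary

/-! ### Simple quotients: comparing modules through dimensions of Hom into simple modules. -/

namespace SimpleQuotient

variable {k R : Type*} [Field k] [Ring R] [Algebra k R]

/-! Put E = End H and view V as an invertible v in E ⊗ S. The slices of v fill S, so a linear map f
on S is determined by (id ⊗ f)v (`linearMap_ext_of_slices`). The pentagon equation says (id ⊗ δ)v =
v₁₂v₁₃, which turns convolution of maps into multiplication of the elements (id ⊗ f)v. These
elements form a finite-dimensional space stable under right multiplication by v, so it contains 1
and v⁻¹; this yields the counit and the antipode. Hence S is a finite-dimensional Hopf algebra A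
with bijective antipode κ (`exists_hopfData_of_pentagon`). Reversing the product exchanges left and
right modules, reversing the coproduct exchanges left and right coideals, so it suffices to prove A
free as a left module over a right coideal subalgebra B.

A projective N maps onto M as soon as dim Hom(M, W) ≤ dim Hom(N, W) for all simple W
(`exists_surjective_of_homRank_le`). Take M = A and choose the simple W that maximises t/l, where t
= dim Hom(M, W) and l = dim W. Then some φ maps Bᵗ onto Mˡ, and both sides have equally large Hom
into W.

The Hopf structure makes φ injective. Through the Galois isomorphisms m ⊗ a ↦ m₀ ⊗ m₁a, φ ⊗ id
becomes a B-linear surjection Bᵗ ⊗ A → Mˡ ⊗ A for the action on left factors. By equality of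
dimensions every map Bᵗ ⊗ A → W kills its kernel, which contains z₀ ⊗ κ(z₁) for each z in ker φ
(`map_lTensor_antipode_eq_zero`). So for each coordinate x of z the coefficients of δ(x) annihilate
W. If x ≠ 0, the antipode identity forces Hom(A, W) = 0, so t = 0, which is absurd.

Thus Mˡ ≅ Bᵗ. Counting maps to the one-dimensional module given by the counit shows t = lr, and
comparing simple quotients again gives M ≅ Bʳ (`IsHopfModule.free`). -/

theorem exists_prod_ker_equiv {M W : Type*} [AddCommGroup M] [Module R M]
    [IsSemisimpleModule R M] [AddCommGroup W] [Module R W] [IsSimpleModule R W] (p : M →ₗ[R] W)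
    (hp : p ≠ 0) : Nonempty ((LinearMap.ker p × W) ≃ₗ[R] M) := by
  have hs := (p.surjective_or_eq_zero).resolve_right hp
  obtain ⟨C, hC⟩ := exists_isCompl (LinearMap.ker p)
  exact ⟨(((LinearEquiv.refl R _).prodCongr ((p.quotKerEquivOfSurjective hs).symm.trans
    (Submodule.quotientEquivOfIsCompl _ C hC))).trans (Submodule.prodEquivOfIsCompl _ C hC))⟩

theorem apply_eq_zero_of_mem_jacobson {M W : Type*} [AddCommGroup M] [Module R M]
    [AddCommGroup W] [Module R W] [IsSimpleModule R W] (g : M →ₗ[R] W) {x : M}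
    (hx : x ∈ Module.jacobson R M) : g x = 0 := by
  rcases g.surjective_or_eq_zero with hg | rfl
  · have hc : IsCoatom (LinearMap.ker g) := by
      rw [← isSimpleModule_iff_isCoatom]
      exact IsSimpleModule.congr (g.quotKerEquivOfSurjective hg)
    exact (sInf_le hc : Module.jacobson R M ≤ _) hx
  · rfl

theorem isSemisimpleModule_quotient_jacobson (M : Type*) [AddCommGroup M] [Module R M]
    [IsArtinian R M] : IsSemisimpleModule R (M ⧸ Module.jacobson R M) :=
  (IsArtinian.isSemisimpleModule_iff_jacobson R _).2 (Module.jacobson_quotient_jacobson R M)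

section HomRank

variable (k R) (M N : Type*) [AddCommGroup M] [Module R M] [AddCommGroup N] [Module R N]
  (W : Type*) [AddCommGroup W] [Module k W] [Module R W] [IsScalarTower k R W]

/-- The dimension over `k` of the space of `R`-linear maps `M → W`. -/
noncomputable def homRank : ℕ := Module.finrank k (M →ₗ[R] W)

variable {M N} in
theorem homRank_congr (e : M ≃ₗ[R] N) : homRank k R M W = homRank k R N W :=
  (LinearEquiv.congrLeft W k e).finrank_eq

variable {M N} in
theorem lcomp_injective_of_surjective {f : M →ₗ[R] N} (hf : Function.Surjective f) :
    Function.Injective (LinearMap.lcomp k W f : (N →ₗ[R] W) →ₗ[k] (M →ₗ[R] W)) := by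
  intro a b hab
  ext x
  obtain ⟨m, rfl⟩ := hf x
  exact LinearMap.congr_fun hab m

variable {M N} in
theorem homRank_eq_of_surjective (f : M →ₗ[R] N) (hf : Function.Surjective f)
    (h : ∀ g : M →ₗ[R] W, ∀ m, f m = 0 → g m = 0) : homRank k R M W = homRank k R N W := by
  refine (LinearEquiv.ofBijective (LinearMap.lcomp k W f :
    (N →ₗ[R] W) →ₗ[k] (M →ₗ[R] W)) ⟨lcomp_injective_of_surjective k R W hf, ?_⟩).finrank_eq.symm
  intro g
  refine ⟨(LinearMap.ker f).liftQ g (fun m hm => h g m hm) ∘ₗ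
    (f.quotKerEquivOfSurjective hf).symm.toLinearMap, ?_⟩
  ext m
  have : (f.quotKerEquivOfSurjective hf).symm (f m) = Submodule.Quotient.mk m := by
    rw [LinearEquiv.symm_apply_eq]; rfl
  simp only [LinearMap.lcomp_apply, LinearMap.comp_apply, LinearEquiv.coe_coe, this]
  exact Submodule.liftQ_apply _ g m

variable [Module k M] [IsScalarTower k R M]

instance finite_hom [Module.Finite k M] [Module.Finite k W] : Module.Finite k (M →ₗ[R] W) :=
  Module.Finite.of_injective (LinearMap.restrictScalarsₗ k R M W k)
    (LinearMap.restrictScalars_injective k)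

theorem finite_submodule [Module.Finite k M] (Y : Submodule R M) : Module.Finite k Y :=
  Module.Finite.of_injective (Y.subtype.restrictScalars k) Subtype.val_injective

theorem homRank_le [Module.Finite k M] [Module.Finite k W] :
    homRank k R M W ≤ Module.finrank k M * Module.finrank k W :=
  (LinearMap.finrank_le_finrank_of_injective (f := LinearMap.restrictScalarsₗ k R M W k)
    (LinearMap.restrictScalars_injective k)).trans_eq (Module.finrank_linearMap k k M W)

variable {M N} in
-- Precomposition with f embeds Hom(N, W) in Hom(M, W). Equal finite dimensions make it onto, so
-- every g factors through f.
theorem eq_zero_of_homRank_eq [Module.Finite k M] [Module.Finite k W]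
    (f : M →ₗ[R] N) (hf : Function.Surjective f)
    (h : homRank k R M W = homRank k R N W) (g : M →ₗ[R] W) {m : M} (hm : f m = 0) :
    g m = 0 := by
  have hF := lcomp_injective_of_surjective k R W hf
  have : Module.Finite k (N →ₗ[R] W) := Module.Finite.of_injective _ hF
  obtain ⟨g', rfl⟩ := (LinearMap.injective_iff_surjective_of_finrank_eq_finrank h.symm).1 hF g
  change g' (f m) = 0
  rw [hm, map_zero]

theorem homRank_prod [Module k N] [IsScalarTower k R N] [Module.Finite k M] [Module.Finite k N] [Module.Finite k W] :
    homRank k R (M × N) W = homRank k R M W + homRank k R N W := by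
  rw [homRank, ← (LinearMap.coprodEquiv (R := R) (M := M) (M₂ := N) (M₃ := W) k).finrank_eq,
    Module.finrank_prod]
  rfl

theorem homRank_self : homRank k R R W = Module.finrank k W :=
  (LinearMap.ringLmapEquivSelf R k W).finrank_eq

/-- `Hom_R(M ⊗ X, W) = Hom_k(X, Hom_R(M, W))`. -/
noncomputable def homTensorEquiv (X : Type*) [AddCommGroup X] [Module k X] :
    (M ⊗[k] X →ₗ[R] W) ≃ₗ[k] (X →ₗ[k] M →ₗ[R] W) where
  toFun f :=
    { toFun := fun x => f ∘ₗ (TensorProduct.AlgebraTensorModule.mk k R M X).flip x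
      map_add' := fun x y => by ext; simp
      map_smul' := fun c x => by
        ext m
        change f (m ⊗ₜ (c • x)) = c • f (m ⊗ₜ x)
        rw [TensorProduct.tmul_smul, ← algebraMap_smul R c, map_smul, algebraMap_smul] }
  map_add' f g := by ext; simp
  map_smul' c f := by ext; simp
  invFun g := TensorProduct.AlgebraTensorModule.lift
    { toFun := fun m =>
        { toFun := fun x => g x m
          map_add' := by simp
          map_smul' := by simp }
      map_add' := fun m n => by ext; simp
      map_smul' := fun c m => by ext; simp }
  left_inv f := by ext; simp
  right_inv g := by ext; simp

theorem homRank_tensor [Module.Finite k M] [Module.Finite k W]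
    (X : Type*) [AddCommGroup X] [Module k X] [Module.Finite k X] :
    homRank k R (M ⊗[k] X) W = Module.finrank k X * homRank k R M W := by
  rw [homRank, (homTensorEquiv k R M W X).finrank_eq, Module.finrank_linearMap]
  rfl

end HomRank

variable (k R)

/-- Induction on dim M: a simple quotient of M also occurs in N by the inequality, so it splits off
both modules, and the inequality persists for the two kernels. -/
theorem exists_surjective_of_isSemisimpleModule [Module.Finite k R] (d : ℕ) :
    ∀ (M N : Type*) [AddCommGroup M] [Module k M] [Module R M] [IsScalarTower k R M]
      [AddCommGroup N] [Module k N] [Module R N] [IsScalarTower k R N]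
      [Module.Finite k M] [Module.Finite k N] [IsSemisimpleModule R M] [IsSemisimpleModule R N],
      Module.finrank k M = d →
      (∀ I : Ideal R, I.IsMaximal → homRank k R M (R ⧸ I) ≤ homRank k R N (R ⧸ I)) →
      ∃ f : N →ₗ[R] M, Function.Surjective f := by
  induction d using Nat.strong_induction_on with
  | _ d ih =>
  intro M N _ _ _ _ _ _ _ _ _ _ _ _ hd h
  rcases subsingleton_or_nontrivial M with hM | hM
  · exact ⟨0, fun x => ⟨0, Subsingleton.elim _ _⟩⟩
  obtain ⟨M', hM'⟩ : ∃ M' : Submodule R M, IsCoatom M' := by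
    obtain h | ⟨m, hm, -⟩ := eq_top_or_exists_le_coatom (⊥ : Submodule R M)
    · exact absurd h bot_ne_top
    · exact ⟨m, hm⟩
  have hs : IsSimpleModule R (M ⧸ M') := isSimpleModule_iff_isCoatom.2 hM'
  obtain ⟨I, hI, ⟨e⟩⟩ := isSimpleModule_iff_quot_maximal.1 hs
  have : IsSimpleModule R (R ⧸ I) := IsSimpleModule.congr e.symm
  let q : M →ₗ[R] R ⧸ I := e.toLinearMap ∘ₗ M'.mkQ
  have hq0 : q ≠ 0 := by
    intro h0
    refine hM'.1 (eq_top_iff.2 fun x _ => ?_)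
    have : q x = 0 := by rw [h0]; rfl
    simpa [q] using this
  have hpos : 0 < homRank k R M (R ⧸ I) := by
    have : Nontrivial (M →ₗ[R] R ⧸ I) := ⟨q, 0, hq0⟩
    exact Module.finrank_pos
  have hposN := hpos.trans_le (h I hI)
  obtain ⟨p, hp0⟩ : ∃ p : N →ₗ[R] R ⧸ I, p ≠ 0 := by
    by_contra! hc
    have : Subsingleton (N →ₗ[R] R ⧸ I) := ⟨fun a b => (hc a).trans (hc b).symm⟩
    exact hposN.ne' Module.finrank_zero_of_subsingleton
  obtain ⟨eM⟩ := exists_prod_ker_equiv q hq0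
  obtain ⟨eN⟩ := exists_prod_ker_equiv p hp0
  have hfin : Module.Finite k (LinearMap.ker q) := finite_submodule k R M _
  have hfin : Module.Finite k (LinearMap.ker p) := finite_submodule k R N _
  have hlt : Module.finrank k (LinearMap.ker q) < d := by
    have h1 := (eM.restrictScalars k).finrank_eq
    rw [Module.finrank_prod, hd] at h1
    have : Nontrivial (R ⧸ I) := IsSimpleModule.nontrivial R _
    have : 0 < Module.finrank k (R ⧸ I) := Module.finrank_pos
    omega
  obtain ⟨f, hf⟩ := ih _ hlt (LinearMap.ker q) (LinearMap.ker p) rfl (by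
    intro J hJ
    have h1 := h J hJ
    rw [← homRank_congr k R (R ⧸ J) eM, ← homRank_congr k R (R ⧸ J) eN,
      homRank_prod, homRank_prod] at h1
    omega)
  refine ⟨eM.toLinearMap ∘ₗ (f.prodMap LinearMap.id) ∘ₗ eN.symm.toLinearMap, ?_⟩
  exact eM.surjective.comp ((hf.prodMap Function.surjective_id).comp eN.symm.surjective)

/-- A finite-dimensional module `M` is a quotient of a projective module `N` as soon as every
simple module `W` satisfies `dim Hom(M, W) ≤ dim Hom(N, W)`. -/
theorem exists_surjective_of_homRank_le [Module.Finite k R]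
    (M N : Type*) [AddCommGroup M] [Module k M] [Module R M] [IsScalarTower k R M]
    [AddCommGroup N] [Module k N] [Module R N] [IsScalarTower k R N]
    [Module.Finite k M] [Module.Finite k N] [Module.Projective R N]
    (h : ∀ I : Ideal R, I.IsMaximal → homRank k R M (R ⧸ I) ≤ homRank k R N (R ⧸ I)) :
    ∃ f : N →ₗ[R] M, Function.Surjective f := by
  have : IsArtinian R M := isArtinian_of_tower k inferInstance
  have : IsArtinian R N := isArtinian_of_tower k inferInstance
  have : IsNoetherian R M := isNoetherian_of_tower k inferInstance
  have := isSemisimpleModule_quotient_jacobson (R := R) M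
  have := isSemisimpleModule_quotient_jacobson (R := R) N
  obtain ⟨f, hf⟩ := exists_surjective_of_isSemisimpleModule k R _ (M ⧸ Module.jacobson R M)
    (N ⧸ Module.jacobson R N) rfl (fun I hI => by
      have : IsSimpleModule R (R ⧸ I) := isSimpleModule_iff_isCoatom.2 hI.out
      -- Maps to a simple module kill the radical, so passing to the semisimple quotients leaves
      -- both Hom dimensions unchanged.
      rw [← homRank_eq_of_surjective k R (R ⧸ I) _ (Submodule.mkQ_surjective _) 
          (fun g m hm => apply_eq_zero_of_mem_jacobson g ((Submodule.Quotient.mk_eq_zero _).1 hm)),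
        ← homRank_eq_of_surjective k R (R ⧸ I) _ (Submodule.mkQ_surjective _) 
          (fun g m hm => apply_eq_zero_of_mem_jacobson g ((Submodule.Quotient.mk_eq_zero _).1 hm))]
      exact h I hI)
  obtain ⟨g, hg⟩ := Module.projective_lifting_property (Module.jacobson R M).mkQ
    (f ∘ₗ (Module.jacobson R N).mkQ) (Submodule.mkQ_surjective _)
  refine ⟨g, LinearMap.range_eq_top.1 ?_⟩
  -- Nakayama: g is onto modulo the radical, and a maximal submodule containing the range would also
  -- contain the radical.
  obtain h | ⟨m, hm, hle⟩ := eq_top_or_exists_le_coatom (LinearMap.range g)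
  · exact h
  refine absurd (eq_top_iff.2 fun x _ => ?_) hm.1
  obtain ⟨y, hy⟩ := (hf.comp (Submodule.mkQ_surjective _)) ((Module.jacobson R M).mkQ x)
  have h1 : (Module.jacobson R M).mkQ (x - g y) = 0 := by
    rw [map_sub, ← hy, sub_eq_zero]
    exact (LinearMap.congr_fun hg y).symm
  have h2 : x - g y ∈ m := (sInf_le hm : Module.jacobson R M ≤ _)
    ((Submodule.Quotient.mk_eq_zero _).1 h1)
  simpa using m.add_mem h2 (hle ⟨y, rfl⟩)

end SimpleQuotient

/-- A Hopf algebra structure with invertible antipode on an algebra `A`, given by its comultiplication,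
counit and antipode. The last two axioms say that the inverse of the antipode is an antipode for
the opposite comultiplication. -/
structure HopfData (k A : Type*) [Field k] [Ring A] [Algebra k A] where
  comul : A →ₐ[k] A ⊗[k] A
  counit : A →ₐ[k] k
  antipode : A ≃ₗ[k] A
  coassoc : ∀ x, TensorProduct.assoc k A A A (LinearMap.rTensor A comul.toLinearMap (comul x)) =
    LinearMap.lTensor A comul.toLinearMap (comul x)
  rTensor_counit : ∀ x, TensorProduct.lid k A (LinearMap.rTensor A counit.toLinearMap (comul x)) = x
  lTensor_counit : ∀ x, TensorProduct.rid k A (LinearMap.lTensor A counit.toLinearMap (comul x)) = x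
  mul_lTensor_antipode : ∀ x, LinearMap.mul' k A
    (LinearMap.lTensor A antipode.toLinearMap (comul x)) = algebraMap k A (counit x)
  mul_rTensor_antipode : ∀ x, LinearMap.mul' k A
    (LinearMap.rTensor A antipode.toLinearMap (comul x)) = algebraMap k A (counit x)
  mul_lTensor_antipode_symm : ∀ x, LinearMap.mul' k A (LinearMap.lTensor A
    antipode.symm.toLinearMap (TensorProduct.comm k A A (comul x))) = algebraMap k A (counit x)
  mul_rTensor_antipode_symm : ∀ x, LinearMap.mul' k A (LinearMap.rTensor A
    antipode.symm.toLinearMap (TensorProduct.comm k A A (comul x))) = algebraMap k A (counit x)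

namespace HopfData

/-! ### Slices of tensors. -/

section Tensor

variable {k M N V : Type*} [Field k] [AddCommGroup M] [Module k M] [AddCommGroup N] [Module k N]
  [AddCommGroup V] [Module k V]

/-- The slice `(id ⊗ μ) : M ⊗ V → M`. -/
noncomputable def rslice (M : Type*) [AddCommGroup M] [Module k M] (μ : Module.Dual k V) :
    M ⊗[k] V →ₗ[k] M :=
  (TensorProduct.rid k M).toLinearMap ∘ₗ LinearMap.lTensor M μ

@[simp] theorem rslice_tmul (μ : Module.Dual k V) (m : M) (v : V) :
    rslice M μ (m ⊗ₜ[k] v) = μ v • m := by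
  simp [rslice]

theorem sum_rslice_tmul {ι : Type*} [Fintype ι] (e : Module.Basis ι k V) (u : M ⊗[k] V) :
    ∑ i, rslice M (e.coord i) u ⊗ₜ[k] e i = u := by
  induction u with
  | zero => simp
  | tmul m v =>
    simp only [rslice_tmul, TensorProduct.smul_tmul, ← TensorProduct.tmul_sum, Module.Basis.coord_apply]
    rw [e.sum_repr]
  | add x y hx hy => simp only [map_add, TensorProduct.add_tmul, Finset.sum_add_distrib, hx, hy]

theorem eq_zero_of_rslice_eq_zero [Module.Finite k V] {u : M ⊗[k] V}
    (h : ∀ μ : Module.Dual k V, rslice M μ u = 0) : u = 0 := by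
  rw [← sum_rslice_tmul (Module.finBasis k V) u]
  simp [h]

theorem rTensor_lTensor_comm {N' : Type*} [AddCommGroup N'] [Module k N'] (f : M →ₗ[k] N)
    (g : V →ₗ[k] N') (u : M ⊗[k] V) :
    LinearMap.rTensor N' f (LinearMap.lTensor M g u) =
      LinearMap.lTensor N g (LinearMap.rTensor V f u) := by
  simp only [← LinearMap.comp_apply, LinearMap.rTensor_comp_lTensor,
    LinearMap.lTensor_comp_rTensor]

theorem exists_lift_of_range_le {f : M →ₗ[k] V} {i : N →ₗ[k] V} (hi : Function.Injective i)
    (h : ∀ x, f x ∈ LinearMap.range i) : ∃ g : M →ₗ[k] N, ∀ x, i (g x) = f x := by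
  obtain ⟨r, hr⟩ := LinearMap.exists_leftInverse_of_injective i (LinearMap.ker_eq_bot.2 hi)
  refine ⟨r ∘ₗ f, fun x => ?_⟩
  obtain ⟨y, hy⟩ := h x
  rw [LinearMap.comp_apply, ← hy]
  exact congrArg i (LinearMap.congr_fun hr y)

end Tensor

variable {k A : Type*} [Field k] [Ring A] [Algebra k A] (𝓗 : HopfData k A)

/-! ### Galois maps of a coaction. -/

section Comodule

variable {M : Type*} [AddCommGroup M] [Module k M] (ρ : M →ₗ[k] M ⊗[k] A)

/-- The map `m ⊗ a ↦ m₀ ⊗ f(m₁) a` attached to a coaction `m ↦ m₀ ⊗ m₁`. -/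
noncomputable def galois (f : A →ₗ[k] A) : M ⊗[k] A →ₗ[k] M ⊗[k] A :=
  LinearMap.lTensor M (LinearMap.mul' k A ∘ₗ LinearMap.rTensor A f) ∘ₗ
    (TensorProduct.assoc k M A A).toLinearMap ∘ₗ LinearMap.rTensor A ρ

theorem galois_tmul (f : A →ₗ[k] A) (m : M) (a : A) :
    galois ρ f (m ⊗ₜ[k] a) = LinearMap.lTensor M (LinearMap.mulRight k a ∘ₗ f) (ρ m) := by
  simp only [galois, LinearMap.comp_apply, LinearMap.rTensor_tmul, LinearEquiv.coe_coe]
  induction ρ m with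
  | zero => simp
  | tmul n x => simp
  | add x y hx hy => simp only [TensorProduct.add_tmul, map_add, hx, hy]

theorem galois_lTensor (f g : A →ₗ[k] A) (a : A) (u : M ⊗[k] A) :
    galois ρ f (LinearMap.lTensor M (LinearMap.mulRight k a ∘ₗ g) u) =
      LinearMap.lTensor M (LinearMap.mulRight k a ∘ₗ LinearMap.mul' k A ∘ₗ TensorProduct.map f g)
        (TensorProduct.assoc k M A A (LinearMap.rTensor A ρ u)) := by
  induction u with
  | zero => simp
  | tmul m x =>
    simp only [LinearMap.lTensor_tmul, galois_tmul, LinearMap.rTensor_tmul]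
    induction ρ m with
    | zero => simp
    | tmul n y => simp [mul_assoc]
    | add x y hx hy => simp only [TensorProduct.add_tmul, map_add, hx, hy]
  | add x y hx hy => simp only [map_add, hx, hy]

/-- By coassociativity the composite is m ⊗ a ↦ m₀ ⊗ f(m₁)g(m₂)a, which collapses when f and g are
convolution inverse. Taking the identity and the antipode, in either order, makes the Galois map
bijective. -/
theorem galois_galois (f g : A →ₗ[k] A)
    (hρ : ∀ m, TensorProduct.assoc k M A A (LinearMap.rTensor A ρ (ρ m)) =
      LinearMap.lTensor M 𝓗.comul.toLinearMap (ρ m))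
    (hε : ∀ m, rslice M 𝓗.counit.toLinearMap (ρ m) = m)
    (h : ∀ x, LinearMap.mul' k A (TensorProduct.map f g (𝓗.comul x)) =
      algebraMap k A (𝓗.counit x)) (z : M ⊗[k] A) :
    galois ρ f (galois ρ g z) = z := by
  induction z with
  | zero => simp
  | tmul m a =>
    rw [galois_tmul, galois_lTensor, hρ]
    conv_rhs => rw [← hε m]
    induction ρ m with
    | zero => simp
    | tmul n x => simp [h, TensorProduct.smul_tmul, Algebra.smul_def]
    | add x y hx hy => simp only [TensorProduct.add_tmul, map_add, hx, hy]
  | add x y hx hy => simp only [map_add, hx, hy]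

end Comodule

/-! ### Hopf modules over a right coideal subalgebra. -/

section HopfModule

variable {B : Subalgebra k A} (δB : B →ₗ[k] B ⊗[k] A)

/-- The action of `B ⊗ A` on `M ⊗ A` for a `B`-module `M`. -/
noncomputable def act (B : Subalgebra k A) (M : Type*) [AddCommGroup M] [Module k M] [Module B M]
    [IsScalarTower k B M] : B ⊗[k] A →ₗ[k] Module.End k (M ⊗[k] A) :=
  TensorProduct.homTensorHomMap (RingHom.id k) M A M A ∘ₗ
    TensorProduct.map (Algebra.lsmul k k M).toLinearMap (LinearMap.mul k A)

section

variable {M N : Type*} [AddCommGroup M] [Module k M] [Module B M] [IsScalarTower k B M]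
  [AddCommGroup N] [Module k N] [Module B N] [IsScalarTower k B N]

@[simp] theorem act_tmul (b : B) (a x : A) (m : M) :
    act B M (b ⊗ₜ a) (m ⊗ₜ x) = (b • m) ⊗ₜ (a * x) := by
  simp [act]

theorem rTensor_act (φ : M →ₗ[B] N) (u : B ⊗[k] A) (z : M ⊗[k] A) :
    LinearMap.rTensor A (φ.restrictScalars k) (act B M u z) =
      act B N u (LinearMap.rTensor A (φ.restrictScalars k) z) := by
  induction u with
  | zero => simp
  | tmul b a =>
    induction z with
    | zero => simp
    | tmul m x => simp
    | add x y hx hy => simp only [map_add, hx, hy]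
  | add x y hx hy => simp only [map_add, LinearMap.add_apply, hx, hy]

theorem lTensor_mulRight_act (a : A) (u : B ⊗[k] A) (z : M ⊗[k] A) :
    LinearMap.lTensor M (LinearMap.mulRight k a) (act B M u z) =
      act B M u (LinearMap.lTensor M (LinearMap.mulRight k a) z) := by
  induction u with
  | zero => simp
  | tmul b a =>
    induction z with
    | zero => simp
    | tmul m x => simp [mul_assoc]
    | add x y hx hy => simp only [map_add, hx, hy]
  | add x y hx hy => simp only [map_add, LinearMap.add_apply, hx, hy]

end

/-- A `B`-module with a compatible coaction of `A`. -/
structure IsHopfModule {M : Type*} [AddCommGroup M] [Module k M] [Module B M]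
    [IsScalarTower k B M] (ρ : M →ₗ[k] M ⊗[k] A) : Prop where
  coassoc : ∀ m, TensorProduct.assoc k M A A (LinearMap.rTensor A ρ (ρ m)) =
      LinearMap.lTensor M 𝓗.comul.toLinearMap (ρ m)
  rslice_counit : ∀ m, rslice M 𝓗.counit.toLinearMap (ρ m) = m
  coaction_smul : ∀ (b : B) (m : M), ρ (b • m) = act B M (δB b) (ρ m)

namespace IsHopfModule

variable {𝓗 δB}
variable {M N : Type*} [AddCommGroup M] [Module k M] [Module B M] [IsScalarTower k B M]
  [AddCommGroup N] [Module k N] [Module B N] [IsScalarTower k B N]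
  {ρ : M →ₗ[k] M ⊗[k] A} {σ : N →ₗ[k] N ⊗[k] A}

theorem galois_antipode_galois (h : IsHopfModule 𝓗 δB ρ) (z : M ⊗[k] A) :
    galois ρ 𝓗.antipode.toLinearMap (galois ρ LinearMap.id z) = z :=
  galois_galois 𝓗 ρ _ _ h.coassoc h.rslice_counit 𝓗.mul_rTensor_antipode z

theorem galois_galois_antipode (h : IsHopfModule 𝓗 δB ρ) (z : M ⊗[k] A) :
    galois ρ LinearMap.id (galois ρ 𝓗.antipode.toLinearMap z) = z :=
  galois_galois 𝓗 ρ _ _ h.coassoc h.rslice_counit 𝓗.mul_lTensor_antipode z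

/-- The Galois map intertwines the action on the left factor with the diagonal action through `δB`;
this is the compatibility of coaction and action. -/
theorem galois_smul (h : IsHopfModule 𝓗 δB ρ) (b : B) (z : M ⊗[k] A) :
    galois ρ LinearMap.id (b • z) = act B M (δB b) (galois ρ LinearMap.id z) := by
  induction z with
  | zero => simp
  | tmul m a =>
    rw [TensorProduct.smul_tmul', galois_tmul, galois_tmul, h.coaction_smul, LinearMap.comp_id,
      lTensor_mulRight_act]
  | add x y hx hy => simp only [smul_add, map_add, hx, hy]

theorem galois_antipode_act (h : IsHopfModule 𝓗 δB ρ) (b : B) (z : M ⊗[k] A) :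
    galois ρ 𝓗.antipode.toLinearMap (act B M (δB b) z) =
      b • galois ρ 𝓗.antipode.toLinearMap z := by
  conv_lhs => rw [← h.galois_galois_antipode z, ← h.galois_smul, h.galois_antipode_galois]

/-- The `B`-linear map `M ⊗ A → N ⊗ A` (for the action of `B` on the left factors) which
corresponds to `φ ⊗ id` for the diagonal actions. -/
noncomputable def transport (hM : IsHopfModule 𝓗 δB ρ) (hN : IsHopfModule 𝓗 δB σ)
    (φ : M →ₗ[B] N) : M ⊗[k] A →ₗ[B] N ⊗[k] A where
  toFun z := galois σ 𝓗.antipode.toLinearMap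
    (LinearMap.rTensor A (φ.restrictScalars k) (galois ρ LinearMap.id z))
  map_add' x y := by simp only [map_add]
  map_smul' b x := by
    rw [hM.galois_smul, rTensor_act, hN.galois_antipode_act]; rfl

theorem transport_surjective (hM : IsHopfModule 𝓗 δB ρ) (hN : IsHopfModule 𝓗 δB σ)
    {φ : M →ₗ[B] N} (hφ : Function.Surjective φ) :
    Function.Surjective (transport hM hN φ) := by
  intro y
  obtain ⟨z, hz⟩ := LinearMap.rTensor_surjective A (g := φ.restrictScalars k) hφ
    (galois σ LinearMap.id y)
  refine ⟨galois ρ 𝓗.antipode.toLinearMap z, ?_⟩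
  simp only [transport, LinearMap.coe_mk, AddHom.coe_mk]
  rw [hM.galois_galois_antipode, hz, hN.galois_antipode_galois]

/-- Supplies explicit kernel elements m₀ ⊗ κ(m₁), the inverse Galois images of m ⊗ 1. -/
theorem transport_galois_antipode (hM : IsHopfModule 𝓗 δB ρ) (hN : IsHopfModule 𝓗 δB σ)
    {φ : M →ₗ[B] N} {m : M} (hm : φ m = 0) :
    transport hM hN φ (galois ρ 𝓗.antipode.toLinearMap (m ⊗ₜ 1)) = 0 := by
  simp only [transport, LinearMap.coe_mk, AddHom.coe_mk]
  rw [hM.galois_galois_antipode]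
  simp [hm]

open SimpleQuotient in
-- Tensoring with A multiplies both Hom dimensions by dim A, so they stay equal and every map to W
-- factors through the transported surjection.
theorem map_lTensor_antipode_eq_zero [Module.Finite k A] [Module.Finite k M]
    (hM : IsHopfModule 𝓗 δB ρ) (hN : IsHopfModule 𝓗 δB σ) [Module.Finite k N]
    {W : Type*} [AddCommGroup W] [Module k W] [Module B W] [IsScalarTower k B W]
    [Module.Finite k W] {φ : M →ₗ[B] N} (hφ : Function.Surjective φ)
    (hW : homRank k B M W = homRank k B N W) (g : M ⊗[k] A →ₗ[B] W) {m : M} (hm : φ m = 0) :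
    g (LinearMap.lTensor M 𝓗.antipode.toLinearMap (ρ m)) = 0 := by
  have h1 : homRank k B (M ⊗[k] A) W = homRank k B (N ⊗[k] A) W := by
    rw [homRank_tensor, homRank_tensor, hW]
  have h2 := eq_zero_of_homRank_eq k B W _ (transport_surjective hM hN hφ) h1 g
    (transport_galois_antipode hM hN hm)
  rw [galois_tmul] at h2
  have h3 : LinearMap.mulRight k (1 : A) ∘ₗ 𝓗.antipode.toLinearMap = 𝓗.antipode.toLinearMap := by
    ext x; simp
  rwa [h3] at h2

variable (ρ) in
/-- The coaction on `M ⊗ V` given by a coaction on `M`. -/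
noncomputable def tensorCoaction (V : Type*) [AddCommGroup V] [Module k V] :
    M ⊗[k] V →ₗ[k] (M ⊗[k] V) ⊗[k] A :=
  (TensorProduct.rightComm k M A V).toLinearMap ∘ₗ LinearMap.rTensor V ρ

variable {V : Type*} [AddCommGroup V] [Module k V]

theorem tensorCoaction_tmul (m : M) (v : V) : tensorCoaction ρ V (m ⊗ₜ v) =
    LinearMap.rTensor A ((TensorProduct.mk k M V).flip v) (ρ m) := by
  simp only [tensorCoaction, LinearMap.comp_apply, LinearMap.rTensor_tmul, LinearEquiv.coe_coe]
  induction ρ m with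
  | zero => simp
  | tmul n x => simp
  | add x y hx hy => simp only [TensorProduct.add_tmul, map_add, hx, hy]

/-- V is a mere multiplicity space; this makes the powers Bᵗ and Mˡ into Hopf modules. -/
theorem tensor (h : IsHopfModule 𝓗 δB ρ) : IsHopfModule 𝓗 δB (tensorCoaction ρ V) where
  coassoc z := by
    induction z with
    | zero => simp
    | tmul m v =>
      have h1 : ∀ u : M ⊗[k] A, TensorProduct.assoc k (M ⊗[k] V) A A
          (LinearMap.rTensor A (tensorCoaction ρ V)
            (LinearMap.rTensor A ((TensorProduct.mk k M V).flip v) u)) =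
          LinearMap.rTensor (A ⊗[k] A) ((TensorProduct.mk k M V).flip v)
            (TensorProduct.assoc k M A A (LinearMap.rTensor A ρ u)) := by
        intro u
        induction u with
        | zero => simp
        | tmul m x =>
          simp only [LinearMap.rTensor_tmul, LinearMap.flip_apply, TensorProduct.mk_apply,
            tensorCoaction_tmul]
          induction ρ m with
          | zero => simp
          | tmul n y => simp
          | add x y hx hy => simp only [TensorProduct.add_tmul, map_add, hx, hy]
        | add x y hx hy => simp only [map_add, hx, hy]
      rw [tensorCoaction_tmul, h1, h.coassoc, rTensor_lTensor_comm]
    | add x y hx hy => simp only [map_add, hx, hy]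
  rslice_counit z := by
    induction z with
    | zero => simp
    | tmul m v =>
      rw [tensorCoaction_tmul]
      conv_rhs => rw [← h.rslice_counit m]
      induction ρ m with
      | zero => simp
      | tmul n x => simp [TensorProduct.smul_tmul']
      | add x y hx hy => simp only [TensorProduct.add_tmul, map_add, hx, hy]
    | add x y hx hy => simp only [map_add, hx, hy]
  coaction_smul b z := by
    induction z with
    | zero => simp
    | tmul m v =>
      rw [TensorProduct.smul_tmul', tensorCoaction_tmul, tensorCoaction_tmul, h.coaction_smul]
      exact rTensor_act ((TensorProduct.AlgebraTensorModule.mk k B M V).flip v) _ _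
    | add x y hx hy => simp only [smul_add, map_add, hx, hy]

end IsHopfModule

variable {𝓗 δB}

theorem rTensor_val_act (u v : B ⊗[k] A) :
    LinearMap.rTensor A B.val.toLinearMap (act B B u v) =
      LinearMap.rTensor A B.val.toLinearMap u * LinearMap.rTensor A B.val.toLinearMap v := by
  induction u with
  | zero => simp
  | tmul b a =>
    induction v with
    | zero => simp
    | tmul m x => simp
    | add x y hx hy => simp only [map_add, mul_add, hx, hy]
  | add x y hx hy => simp only [map_add, add_mul, LinearMap.add_apply, hx, hy]

theorem act_eq_mul (u : B ⊗[k] A) (v : A ⊗[k] A) :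
    act B A u v = LinearMap.rTensor A B.val.toLinearMap u * v := by
  induction u with
  | zero => simp
  | tmul b a =>
    induction v with
    | zero => simp
    | tmul m x => simp [Subalgebra.smul_def]
    | add x y hx hy => simp only [map_add, mul_add, hx, hy]
  | add x y hx hy => simp only [map_add, add_mul, LinearMap.add_apply, hx, hy]

theorem rTensor_val_injective (X : Type*) [AddCommGroup X] [Module k X] :
    Function.Injective (LinearMap.rTensor X B.val.toLinearMap) :=
  Module.Flat.rTensor_preserves_injective_linearMap _ Subtype.val_injective

theorem isHopfModule_comul (hδ : ∀ b, LinearMap.rTensor A B.val.toLinearMap (δB b) = 𝓗.comul b) :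
    IsHopfModule 𝓗 δB 𝓗.comul.toLinearMap where
  coassoc := 𝓗.coassoc
  rslice_counit := 𝓗.lTensor_counit
  coaction_smul b m := by
    rw [act_eq_mul, hδ, Subalgebra.smul_def]
    simp

/-- The axioms are inherited from A, since B ⊗ X embeds in A ⊗ X over a field. -/
theorem isHopfModule_restrict
    (hδ : ∀ b, LinearMap.rTensor A B.val.toLinearMap (δB b) = 𝓗.comul b) :
    IsHopfModule 𝓗 δB δB where
  coassoc b := by
    apply rTensor_val_injective
    have h1 : ∀ u : B ⊗[k] A, LinearMap.rTensor (A ⊗[k] A) B.val.toLinearMap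
        (TensorProduct.assoc k B A A (LinearMap.rTensor A δB u)) = TensorProduct.assoc k A A A
        (LinearMap.rTensor A 𝓗.comul.toLinearMap (LinearMap.rTensor A B.val.toLinearMap u)) := by
      intro u
      induction u with
      | zero => simp
      | tmul b x =>
        simp only [LinearMap.rTensor_tmul, AlgHom.toLinearMap_apply, Subalgebra.coe_val, ← hδ]
        induction δB b with
        | zero => simp
        | tmul n y => simp
        | add x y hx hy => simp only [TensorProduct.add_tmul, map_add, hx, hy]
      | add x y hx hy => simp only [map_add, hx, hy]
    rw [h1, hδ, 𝓗.coassoc, ← hδ, rTensor_lTensor_comm]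
  rslice_counit b := by
    apply Subtype.val_injective
    have h2 := 𝓗.lTensor_counit b
    rw [← hδ] at h2
    refine Eq.trans ?_ h2
    induction δB b with
    | zero => simp
    | tmul n y => simp
    | add x y hx hy => simp only [map_add, Subalgebra.coe_add, hx, hy]
  coaction_smul b m := by
    apply rTensor_val_injective
    rw [rTensor_val_act, hδ, hδ, hδ, smul_eq_mul, Subalgebra.coe_mul, map_mul]

/-- If all coefficients of `δ x` annihilate the module `W`, then `x = 0` or `Hom_B(A, W) = 0`. -/
theorem hom_eq_zero_of_rslice_smul_eq_zero [Module.Finite k A]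
    (hδ : ∀ b, LinearMap.rTensor A B.val.toLinearMap (δB b) = 𝓗.comul b)
    {W : Type*} [AddCommGroup W] [Module k W] [Module B W] [IsScalarTower k B W]
    {x : B} (hx : x ≠ 0)
    (h : ∀ (μ : Module.Dual k A) (w : W), rslice B μ (δB x) • w = 0) (f : A →ₗ[B] W) : f = 0 := by
  obtain ⟨μ, hμ⟩ : ∃ μ : Module.Dual k A, μ x ≠ 0 := by
    by_contra! hc
    exact hx (Subtype.ext ((Module.forall_dual_apply_eq_zero_iff k (x : A)).1 hc))
  -- This slice of δ(x) lies in B and has counit μ(x) ≠ 0.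
  set y := rslice B μ (δB x) with hy
  have hεy : 𝓗.counit y = μ x := by
    conv_rhs => rw [← 𝓗.rTensor_counit x, ← hδ]
    rw [hy]
    induction δB x with
    | zero => simp
    | tmul n y => simp [mul_comm]
    | add x y hx hy => simp only [map_add, Subalgebra.coe_add, hx, hy]
  -- By coassociativity, coefficients of δ(y) are coefficients of δ(x), taken along the convolution
  -- of ν and μ.
  have hann : ∀ (ν : Module.Dual k A) (w : W), rslice B ν (δB y) • w = 0 := by
    intro ν w
    have h1 : ∀ u : B ⊗[k] A, rslice B ν (δB (rslice B μ u)) =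
        rslice B (LinearMap.mul' k k ∘ₗ TensorProduct.map ν μ)
          (TensorProduct.assoc k B A A (LinearMap.rTensor A δB u)) := by
      intro u
      induction u with
      | zero => simp
      | tmul b x =>
        simp only [rslice_tmul, map_smul, LinearMap.rTensor_tmul]
        induction δB b with
        | zero => simp
        | tmul n y => simp [smul_smul, mul_comm]
        | add x y hx hy => simp only [TensorProduct.add_tmul, smul_add, map_add, hx, hy]
      | add x y hx hy => simp only [map_add, hx, hy]
    have h2 : ∀ (u : B ⊗[k] A) (τ : Module.Dual k (A ⊗[k] A)), rslice B τ
        (LinearMap.lTensor B 𝓗.comul.toLinearMap u) =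
        rslice B (τ ∘ₗ 𝓗.comul.toLinearMap) u := by
      intro u τ
      induction u with
      | zero => simp
      | tmul b x => simp
      | add x y hx hy => simp only [map_add, hx, hy]
    rw [hy, h1, (isHopfModule_restrict hδ).coassoc, h2]
    exact h _ w
  ext a
  -- B-linearity gives f(y₁κ(y₂)a) = y₁ · f(κ(y₂)a) = 0, whereas y₁κ(y₂) = ε(y).
  have key : ∀ u : B ⊗[k] A, (∀ (ν : Module.Dual k A) (w : W), rslice B ν u • w = 0) →
      f (LinearMap.mul' k A (LinearMap.lTensor A 𝓗.antipode.toLinearMap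
        (LinearMap.rTensor A B.val.toLinearMap u)) * a) = 0 := by
    intro u hu
    rw [← sum_rslice_tmul (Module.finBasis k A) u]
    simp only [map_sum, LinearMap.rTensor_tmul, LinearMap.lTensor_tmul, LinearMap.mul'_apply,
      Finset.sum_mul]
    refine Finset.sum_eq_zero fun i _ => ?_
    rw [mul_assoc]
    exact (f.map_smul (rslice B ((Module.finBasis k A).coord i) u) _).trans (hu _ _)
  have h3 := key _ hann
  rw [hδ, 𝓗.mul_lTensor_antipode, hεy] at h3
  have h4 := f.map_smul (algebraMap k B (μ x)) a
  have h5 : (algebraMap k B (μ x)) • a = algebraMap k A (μ x) * a := rfl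
  rw [h5, h3, algebraMap_smul] at h4
  exact (smul_eq_zero.1 h4.symm).resolve_left hμ

end HopfModule

end HopfData

namespace HopfData

variable {k A : Type*} [Field k] [Ring A] [Algebra k A] (𝓗 : HopfData k A)

/-! ### Freeness over right coideal subalgebras. -/

section Freeness

variable (B : Subalgebra k A)

/-- The kernel of the counit, as a left ideal of `B`. -/
noncomputable def augmentation : Ideal B := RingHom.ker (𝓗.counit.comp B.val)

theorem sub_mem_augmentation (b : B) :
    b - algebraMap k B (𝓗.counit b) ∈ 𝓗.augmentation B := by
  change 𝓗.counit (b - algebraMap k B (𝓗.counit b) : B) = 0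
  simp

theorem augmentation_isMaximal : (𝓗.augmentation B).IsMaximal := by
  rw [Ideal.isMaximal_iff]
  refine ⟨fun h => ?_, fun J x hJ hx hxJ => ?_⟩
  · have h : 𝓗.counit (1 : B) = 0 := h
    simp at h
  · have hx : 𝓗.counit x ≠ 0 := hx
    have h := J.sub_mem hxJ (hJ (𝓗.sub_mem_augmentation B x))
    rw [sub_sub_cancel] at h
    have h2 := J.mul_mem_left (algebraMap k B (𝓗.counit x)⁻¹) h
    rwa [← map_mul, inv_mul_cancel₀ hx, map_one] at h2

/-- The one-dimensional simple module is what later forces l to divide t. -/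
theorem finrank_quotient_augmentation :
    Module.finrank k (B ⧸ 𝓗.augmentation B) = 1 := by
  refine finrank_eq_one (Submodule.Quotient.mk 1) (fun h => ?_) (fun w => ?_)
  · exact (Ideal.isMaximal_iff.1 (𝓗.augmentation_isMaximal B)).1
      ((Submodule.Quotient.mk_eq_zero _).1 h)
  · obtain ⟨b, rfl⟩ := Submodule.Quotient.mk_surjective _ w
    refine ⟨𝓗.counit b, ?_⟩
    rw [← Submodule.Quotient.mk_smul, eq_comm, Submodule.Quotient.eq,
      ← Algebra.algebraMap_eq_smul_one]
    exact 𝓗.sub_mem_augmentation B b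

variable {B}

open IsHopfModule in
-- Test h on maps g that apply `lam` to V and μ ∘ κ⁻¹ to A, then send b to b · w; the κ⁻¹ cancels
-- the antipode in the hypothesis.
theorem rslice_smul_of_tensorCoaction {δB : B →ₗ[k] B ⊗[k] A} {V : Type*} [AddCommGroup V]
    [Module k V] {W : Type*} [AddCommGroup W] [Module k W] [Module B W] [IsScalarTower k B W]
    {z : B ⊗[k] V} (h : ∀ g : (B ⊗[k] V) ⊗[k] A →ₗ[B] W,
      g (LinearMap.lTensor _ 𝓗.antipode.toLinearMap (tensorCoaction δB V z)) = 0)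
    (lam : Module.Dual k V) (μ : Module.Dual k A) (w : W) :
    rslice B μ (δB (rslice B lam z)) • w = 0 := by
  let g : (B ⊗[k] V) ⊗[k] A →ₗ[B] W :=
    LinearMap.toSpanSingleton B W w ∘ₗ
      (TensorProduct.AlgebraTensorModule.rid k B B).toLinearMap ∘ₗ
      TensorProduct.AlgebraTensorModule.map LinearMap.id lam ∘ₗ
      (TensorProduct.AlgebraTensorModule.rid k B (B ⊗[k] V)).toLinearMap ∘ₗ
      TensorProduct.AlgebraTensorModule.map LinearMap.id (μ ∘ₗ 𝓗.antipode.symm.toLinearMap)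
  have hg : ∀ z : B ⊗[k] V, g (LinearMap.lTensor _ 𝓗.antipode.toLinearMap
      (tensorCoaction δB V z)) = rslice B μ (δB (rslice B lam z)) • w := by
    intro z
    induction z with
    | zero => simp
    | tmul b v =>
      rw [tensorCoaction_tmul]
      simp only [rslice_tmul, map_smul]
      induction δB b with
      | zero => simp
      | tmul n y =>
        simp only [g, LinearMap.comp_apply, LinearMap.rTensor_tmul, LinearMap.lTensor_tmul,
          LinearEquiv.coe_coe, TensorProduct.AlgebraTensorModule.map_tmul, LinearMap.id_apply,
          TensorProduct.AlgebraTensorModule.rid_tmul, LinearEquiv.symm_apply_apply,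
          TensorProduct.smul_tmul', LinearMap.flip_apply, TensorProduct.mk_apply,
          LinearMap.toSpanSingleton_apply, rslice_tmul]
      | add x y hx hy => simp only [map_add, smul_add, add_smul, hx, hy]
    | add x y hx hy => simp only [map_add, add_smul, hx, hy]
  rw [← hg]
  exact h g

open SimpleQuotient in
theorem exists_max_ratio (k : Type*) {B : Type*} [Field k] [Ring B] [Algebra k B]
    [Module.Finite k B] [Nontrivial B] (M : Type*) [AddCommGroup M] [Module k M] [Module B M]
    [IsScalarTower k B M] [Module.Finite k M] :
    ∃ I : Ideal B, I.IsMaximal ∧ ∀ J : Ideal B, J.IsMaximal →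
      homRank k B M (B ⧸ J) * Module.finrank k (B ⧸ I) ≤
        homRank k B M (B ⧸ I) * Module.finrank k (B ⧸ J) := by
  -- There may be many maximal left ideals, but both dimensions are bounded, so only finitely many
  -- ratios occur.
  let T : Set (ℕ × ℕ) := (fun I : Ideal B => (homRank k B M (B ⧸ I), Module.finrank k (B ⧸ I))) ''
    {I | I.IsMaximal}
  have hle : ∀ I : Ideal B, Module.finrank k (B ⧸ I) ≤ Module.finrank k B := fun I =>
    (I.mkQ.restrictScalars k).finrank_le_finrank_of_surjective I.mkQ_surjective
  have hT : T.Finite := by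
    refine ((Set.finite_Iic (Module.finrank k M * Module.finrank k B)).prod
      (Set.finite_Iic (Module.finrank k B))).subset ?_
    rintro _ ⟨I, -, rfl⟩
    exact ⟨(homRank_le k B M _).trans (Nat.mul_le_mul_left _ (hle I)), hle I⟩
  obtain ⟨I₀, hI₀⟩ := Ideal.exists_maximal B
  obtain ⟨_, ⟨I, hI, rfl⟩, hmax⟩ := T.exists_max_image (fun p => (p.1 : ℚ) / p.2) hT
    ⟨_, I₀, hI₀, rfl⟩
  have hpos : ∀ J : Ideal B, J.IsMaximal → (0 : ℚ) < Module.finrank k (B ⧸ J) := fun J hJ => by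
    have : IsSimpleModule B (B ⧸ J) := isSimpleModule_iff_isCoatom.2 hJ.out
    have : Nontrivial (B ⧸ J) := IsSimpleModule.nontrivial B _
    exact_mod_cast Module.finrank_pos (R := k) (M := B ⧸ J)
  refine ⟨I, hI, fun J hJ => ?_⟩
  have h := hmax _ ⟨J, hJ, rfl⟩
  rw [div_le_div_iff₀ (hpos J hJ) (hpos I hI)] at h
  exact_mod_cast h

open SimpleQuotient IsHopfModule in
theorem IsHopfModule.free [Module.Finite k A] {M : Type*} [AddCommGroup M] [Module k M]
    [Module B M] [IsScalarTower k B M] [Module.Finite k M] [Nontrivial M]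
    {δB : B →ₗ[k] B ⊗[k] A} {ρ : M →ₗ[k] M ⊗[k] A} (hM : IsHopfModule 𝓗 δB ρ)
    (hδ : ∀ b, LinearMap.rTensor A B.val.toLinearMap (δB b) = 𝓗.comul b)
    (hzero : ∀ (I : Ideal B) {x : B}, x ≠ 0 →
      (∀ (μ : Module.Dual k A) (w : B ⧸ I), rslice B μ (δB x) • w = 0) →
      ∀ f : M →ₗ[B] B ⧸ I, f = 0) :
    Module.Free B M := by
  have hA : Nontrivial A := 𝓗.counit.toRingHom.domain_nontrivial
  obtain ⟨I, hI, hmax⟩ := exists_max_ratio k (B := B) M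
  have hsI : IsSimpleModule B (B ⧸ I) := isSimpleModule_iff_isCoatom.2 hI.out
  have hnI : Nontrivial (B ⧸ I) := IsSimpleModule.nontrivial B _
  set l := Module.finrank k (B ⧸ I) with hl
  set t := homRank k B M (B ⧸ I) with ht
  have hl0 : 0 < l := Module.finrank_pos
  have hF : ∀ (n : ℕ) (J : Ideal B), homRank k B (B ⊗[k] (Fin n → k)) (B ⧸ J) =
      n * Module.finrank k (B ⧸ J) := fun n J => by
    rw [homRank_tensor, homRank_self, Module.finrank_fin_fun]
  have hX : ∀ (J : Ideal B), homRank k B (M ⊗[k] (Fin l → k)) (B ⧸ J) =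
      l * homRank k B M (B ⧸ J) := fun J => by
    rw [homRank_tensor, Module.finrank_fin_fun]
  -- Maximality of t/l is precisely l · dim Hom(M, B/J) ≤ t · dim(B/J), with equality at J = I.
  obtain ⟨φ, hφ⟩ := exists_surjective_of_homRank_le k B (M ⊗[k] (Fin l → k))
    (B ⊗[k] (Fin t → k)) (fun J hJ => by
      rw [hF, hX, mul_comm]
      exact hmax J hJ)
  have hrank : homRank k B (B ⊗[k] (Fin t → k)) (B ⧸ I) =
      homRank k B (M ⊗[k] (Fin l → k)) (B ⧸ I) := by
    rw [hF, hX, mul_comm]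
  have hinj : Function.Injective φ := by
    rw [injective_iff_map_eq_zero]
    intro z hz
    refine eq_zero_of_rslice_eq_zero fun lam => ?_
    by_contra hne
    have hkill := 𝓗.rslice_smul_of_tensorCoaction (δB := δB) (fun g =>
      map_lTensor_antipode_eq_zero (isHopfModule_restrict hδ).tensor hM.tensor hφ hrank g hz) lam
    have h0 := hzero I hne hkill
    -- If Hom(M, B/I) vanishes, the source of φ is zero while its target Mˡ is not.
    have ht0 : t = 0 := by
      have : Subsingleton (M →ₗ[B] B ⧸ I) := ⟨fun a b => (h0 a).trans (h0 b).symm⟩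
      exact Module.finrank_zero_of_subsingleton
    have h1 := (φ.restrictScalars k).finrank_le_finrank_of_surjective hφ
    rw [Module.finrank_tensorProduct, Module.finrank_tensorProduct, Module.finrank_fin_fun,
      Module.finrank_fin_fun, ht0, mul_zero] at h1
    have h2 : 0 < Module.finrank k M := Module.finrank_pos
    exact absurd (Nat.mul_pos h2 hl0) (by omega)
  let e := LinearEquiv.ofBijective φ ⟨hinj, hφ⟩
  have hcount : ∀ J : Ideal B, t * Module.finrank k (B ⧸ J) = l * homRank k B M (B ⧸ J) :=
    fun J => by rw [← hF, ← hX, homRank_congr k B _ e]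
  set r := homRank k B M (B ⧸ 𝓗.augmentation B) with hr
  have htr : t = l * r := by
    have := hcount (𝓗.augmentation B)
    rwa [finrank_quotient_augmentation, mul_one] at this
  -- Cancelling l in the counts for Mˡ ≅ Bˡʳ shows that M and Bʳ have equal Hom into each simple
  -- module.
  obtain ⟨ψ, hψ⟩ := exists_surjective_of_homRank_le k B M (B ⊗[k] (Fin r → k)) (fun J hJ => by
    rw [hF]
    refine le_of_eq (Nat.eq_of_mul_eq_mul_left hl0 ?_)
    rw [← hcount J, htr, mul_assoc])
  have hdim : Module.finrank k (B ⊗[k] (Fin r → k)) = Module.finrank k M := by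
    have h1 := (e.restrictScalars k).finrank_eq
    rw [Module.finrank_tensorProduct, Module.finrank_tensorProduct, Module.finrank_fin_fun,
      Module.finrank_fin_fun, htr] at h1
    rw [Module.finrank_tensorProduct, Module.finrank_fin_fun]
    refine Nat.eq_of_mul_eq_mul_left hl0 ?_
    linarith
  have hψi : Function.Injective ψ :=
    (LinearMap.injective_iff_surjective_of_finrank_eq_finrank (f := ψ.restrictScalars k) hdim).2 hψ
  exact Module.Free.of_equiv (LinearEquiv.ofBijective ψ ⟨hψi, hψ⟩)

/-- A finite-dimensional Hopf algebra is free as a left module over every right coideal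
subalgebra. -/
theorem free_of_rightCoideal [Module.Finite k A]
    (hB : ∀ b : B, 𝓗.comul b ∈ LinearMap.range (LinearMap.rTensor A B.val.toLinearMap)) :
    Module.Free B A := by
  obtain ⟨δB, hδ⟩ := exists_lift_of_range_le (f := 𝓗.comul.toLinearMap ∘ₗ B.val.toLinearMap)
    (rTensor_val_injective A) hB
  replace hδ : ∀ b, LinearMap.rTensor A B.val.toLinearMap (δB b) = 𝓗.comul b := hδ
  have hA : Nontrivial A := 𝓗.counit.toRingHom.domain_nontrivial
  exact (isHopfModule_comul hδ).free 𝓗 hδ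
    fun I _ hx h => hom_eq_zero_of_rslice_smul_eq_zero hδ hx h

end Freeness

/-! ### Opposite product and opposite coproduct. -/

/-- The opposite comultiplication. -/
noncomputable def comulCop : A →ₐ[k] A ⊗[k] A :=
  (Algebra.TensorProduct.comm k A A).toAlgHom.comp 𝓗.comul

theorem comulCop_apply (x : A) : 𝓗.comulCop x = TensorProduct.comm k A A (𝓗.comul x) :=
  rfl

/-- The Hopf algebra with the opposite comultiplication. -/
noncomputable def cop : HopfData k A where
  comul := 𝓗.comulCop
  counit := 𝓗.counit
  antipode := 𝓗.antipode.symm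
  coassoc x := by
    let rev : A ⊗[k] (A ⊗[k] A) →ₗ[k] A ⊗[k] (A ⊗[k] A) :=
      (TensorProduct.assoc k A A A).toLinearMap ∘ₗ (TensorProduct.comm k A (A ⊗[k] A)).toLinearMap ∘ₗ
        LinearMap.lTensor A (TensorProduct.comm k A A).toLinearMap
    have h := congrArg rev (𝓗.coassoc x)
    refine Eq.trans ?_ (h.symm.trans ?_)
    · rw [comulCop_apply]
      induction 𝓗.comul x with
      | zero => simp
      | tmul a b =>
        simp only [TensorProduct.comm_tmul, LinearMap.rTensor_tmul, LinearMap.lTensor_tmul,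
          AlgHom.toLinearMap_apply, comulCop_apply]
        induction 𝓗.comul b with
        | zero => simp
        | tmul c d => simp [rev]
        | add x y hx hy =>
          simp only [TensorProduct.add_tmul, TensorProduct.tmul_add, map_add, hx, hy]
      | add x y hx hy => simp only [map_add, hx, hy]
    · rw [comulCop_apply]
      induction 𝓗.comul x with
      | zero => simp
      | tmul a b =>
        simp only [TensorProduct.comm_tmul, LinearMap.rTensor_tmul, LinearMap.lTensor_tmul,
          AlgHom.toLinearMap_apply, comulCop_apply]
        induction 𝓗.comul a with
        | zero => simp
        | tmul c d => simp [rev]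
        | add x y hx hy =>
          simp only [TensorProduct.add_tmul, TensorProduct.tmul_add, map_add, hx, hy]
      | add x y hx hy => simp only [map_add, hx, hy]
  rTensor_counit x := by
    refine Eq.trans ?_ (𝓗.lTensor_counit x)
    rw [comulCop_apply]
    induction 𝓗.comul x with
    | zero => simp
    | tmul a b => simp
    | add x y hx hy => simp only [map_add, hx, hy]
  lTensor_counit x := by
    refine Eq.trans ?_ (𝓗.rTensor_counit x)
    rw [comulCop_apply]
    induction 𝓗.comul x with
    | zero => simp
    | tmul a b => simp
    | add x y hx hy => simp only [map_add, hx, hy]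
  mul_lTensor_antipode := 𝓗.mul_lTensor_antipode_symm
  mul_rTensor_antipode := 𝓗.mul_rTensor_antipode_symm
  mul_lTensor_antipode_symm x := by
    refine Eq.trans ?_ (𝓗.mul_lTensor_antipode x)
    rw [comulCop_apply]
    induction 𝓗.comul x with
    | zero => simp
    | tmul a b => simp
    | add x y hx hy => simp only [map_add, hx, hy]
  mul_rTensor_antipode_symm x := by
    refine Eq.trans ?_ (𝓗.mul_rTensor_antipode x)
    rw [comulCop_apply]
    induction 𝓗.comul x with
    | zero => simp
    | tmul a b => simp
    | add x y hx hy => simp only [map_add, hx, hy]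

section Opposite

open MulOpposite

/-- The comultiplication of `A` as a map on the opposite algebra. -/
noncomputable def comulOp : Aᵐᵒᵖ →ₐ[k] Aᵐᵒᵖ ⊗[k] Aᵐᵒᵖ :=
  (Algebra.TensorProduct.opAlgEquiv k k A A).symm.toAlgHom.comp (AlgHom.op 𝓗.comul)

theorem comulOp_op (x : A) : 𝓗.comulOp (op x) =
    TensorProduct.map (opLinearEquiv k).toLinearMap (opLinearEquiv k).toLinearMap (𝓗.comul x) :=
  rfl

/-- The counit of `A` as a map on the opposite algebra. -/
noncomputable def counitOp : Aᵐᵒᵖ →ₐ[k] k :=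
  𝓗.counit.fromOpposite (fun _ _ => mul_comm _ _)

theorem counitOp_op (x : A) : 𝓗.counitOp (op x) = 𝓗.counit x :=
  rfl

/-- The Hopf algebra with the opposite multiplication. -/
noncomputable def op : HopfData k Aᵐᵒᵖ where
  comul := 𝓗.comulOp
  counit := 𝓗.counitOp
  antipode := (opLinearEquiv k).symm.trans (𝓗.antipode.symm.trans (opLinearEquiv k))
  coassoc x := by
    induction x using MulOpposite.rec' with | _ x =>
    have h := congrArg (TensorProduct.map (opLinearEquiv k).toLinearMap (TensorProduct.map
      (opLinearEquiv k).toLinearMap (opLinearEquiv k).toLinearMap)) (𝓗.coassoc x)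
    rw [comulOp_op]
    refine Eq.trans ?_ (h.trans ?_)
    · induction 𝓗.comul x with
      | zero => simp
      | tmul a b =>
        simp only [TensorProduct.map_tmul, LinearEquiv.coe_coe, coe_opLinearEquiv,
          LinearMap.rTensor_tmul, AlgHom.toLinearMap_apply, comulOp_op]
        induction 𝓗.comul a with
        | zero => simp
        | tmul c d => simp
        | add x y hx hy => simp only [TensorProduct.add_tmul, map_add, hx, hy]
      | add x y hx hy => simp only [map_add, hx, hy]
    · induction 𝓗.comul x with
      | zero => simp
      | tmul a b =>
        simp only [TensorProduct.map_tmul, LinearEquiv.coe_coe, coe_opLinearEquiv,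
          LinearMap.lTensor_tmul, AlgHom.toLinearMap_apply, comulOp_op]
      | add x y hx hy => simp only [map_add, hx, hy]
  rTensor_counit x := by
    induction x using MulOpposite.rec' with | _ x =>
    refine Eq.trans ?_ (congrArg MulOpposite.op (𝓗.rTensor_counit x))
    rw [comulOp_op]
    induction 𝓗.comul x with
    | zero => simp
    | tmul a b => simp [counitOp_op]
    | add x y hx hy => simp only [map_add, op_add, hx, hy]
  lTensor_counit x := by
    induction x using MulOpposite.rec' with | _ x =>
    refine Eq.trans ?_ (congrArg MulOpposite.op (𝓗.lTensor_counit x))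
    rw [comulOp_op]
    induction 𝓗.comul x with
    | zero => simp
    | tmul a b => simp [counitOp_op]
    | add x y hx hy => simp only [map_add, op_add, hx, hy]
  mul_lTensor_antipode x := by
    induction x using MulOpposite.rec' with | _ x =>
    refine Eq.trans ?_ (congrArg MulOpposite.op (𝓗.mul_rTensor_antipode_symm x))
    rw [comulOp_op]
    induction 𝓗.comul x with
    | zero => simp
    | tmul a b => simp
    | add x y hx hy => simp only [map_add, op_add, hx, hy]
  mul_rTensor_antipode x := by
    induction x using MulOpposite.rec' with | _ x =>
    refine Eq.trans ?_ (congrArg MulOpposite.op (𝓗.mul_lTensor_antipode_symm x))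
    rw [comulOp_op]
    induction 𝓗.comul x with
    | zero => simp
    | tmul a b => simp
    | add x y hx hy => simp only [map_add, op_add, hx, hy]
  mul_lTensor_antipode_symm x := by
    induction x using MulOpposite.rec' with | _ x =>
    refine Eq.trans ?_ (congrArg MulOpposite.op (𝓗.mul_rTensor_antipode x))
    rw [comulOp_op]
    induction 𝓗.comul x with
    | zero => simp
    | tmul a b => simp
    | add x y hx hy => simp only [map_add, op_add, hx, hy]
  mul_rTensor_antipode_symm x := by
    induction x using MulOpposite.rec' with | _ x =>
    refine Eq.trans ?_ (congrArg MulOpposite.op (𝓗.mul_lTensor_antipode x))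
    rw [comulOp_op]
    induction 𝓗.comul x with
    | zero => simp
    | tmul a b => simp
    | add x y hx hy => simp only [map_add, op_add, hx, hy]

variable {𝓗} in
theorem comul_op_mem {B : Subalgebra k A} {x : A}
    (hx : 𝓗.comul x ∈ LinearMap.range (LinearMap.rTensor A B.val.toLinearMap)) :
    𝓗.op.comul (MulOpposite.op x) ∈
      LinearMap.range (LinearMap.rTensor Aᵐᵒᵖ B.op.val.toLinearMap) := by
  obtain ⟨u, hu⟩ := hx
  change 𝓗.comulOp (MulOpposite.op x) ∈ _
  rw [comulOp_op, ← hu]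
  clear hu
  induction u with
  | zero => simp
  | tmul b a => exact ⟨(⟨MulOpposite.op b, b.2⟩ : B.op) ⊗ₜ MulOpposite.op a, rfl⟩
  | add x y hx hy => simpa only [map_add] using add_mem hx hy

/-- A finite-dimensional Hopf algebra is free as a left and as a right module over every right
coideal subalgebra. -/
theorem free_and_free_op_of_rightCoideal [Module.Finite k A] (B : Subalgebra k A)
    (hB : ∀ b ∈ B, 𝓗.comul b ∈ LinearMap.range (LinearMap.rTensor A B.val.toLinearMap)) :
    Module.Free B A ∧ Module.Free B.op A := by
  refine ⟨𝓗.free_of_rightCoideal fun b => hB b b.2, ?_⟩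
  -- Reversing only the product keeps B a right coideal and turns its right modules into left ones.
  have := 𝓗.op.free_of_rightCoideal (B := B.op) fun b => comul_op_mem (hB b.1.unop b.2)
  let e : Aᵐᵒᵖ ≃ₗ[B.op] A :=
    { toFun := unop
      invFun := MulOpposite.op
      left_inv := fun _ => rfl
      right_inv := fun _ => rfl
      map_add' := fun _ _ => rfl
      map_smul' := fun _ _ => rfl }
  exact Module.Free.of_equiv e

variable {𝓗} in
theorem comul_cop_mem {B : Subalgebra k A} {x : A}
    (hx : 𝓗.comul x ∈ LinearMap.range (LinearMap.lTensor A B.val.toLinearMap)) :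
    𝓗.cop.comul x ∈ LinearMap.range (LinearMap.rTensor A B.val.toLinearMap) := by
  obtain ⟨u, hu⟩ := hx
  refine ⟨TensorProduct.comm k A B u, ?_⟩
  change _ = Algebra.TensorProduct.comm k A A (𝓗.comul x)
  rw [← hu]
  clear hu
  induction u with
  | zero => simp
  | tmul b a => simp
  | add x y hx hy => simp only [map_add, hx, hy]

end Opposite

end HopfData

/-! ### Hopf algebra structure from an invertible v with (id ⊗ δ)v = v₁₂v₁₃. -/

namespace HopfData

/-- Right multiplication by v is injective on the finite-dimensional C, hence onto: solving cv = v
gives c = 1 and solving cv = 1 gives c = w. -/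
theorem one_mem_and_inv_mem {k R : Type*} [Field k] [Ring R] [Algebra k R] [Module.Finite k R]
    (C : Submodule k R) {v w : R} (hvw : v * w = 1) (hv : v ∈ C)
    (hC : ∀ c ∈ C, c * v ∈ C) : 1 ∈ C ∧ w ∈ C := by
  let r : C →ₗ[k] C := (LinearMap.mulRight k v).restrict hC
  have hinj : Function.Injective r := by
    intro a b hab
    have h : (a : R) * v = b * v := congrArg Subtype.val hab
    have h2 := congrArg (· * w) h
    simp only [mul_assoc, hvw, mul_one] at h2
    exact Subtype.ext h2
  have hsurj := LinearMap.surjective_of_injective hinj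
  have h1 : 1 ∈ C := by
    obtain ⟨c, hc⟩ := hsurj ⟨v, hv⟩
    have h : (c : R) * v = v := congrArg Subtype.val hc
    have h2 := congrArg (· * w) h
    simp only [mul_assoc, hvw, mul_one] at h2
    exact h2 ▸ c.2
  refine ⟨h1, ?_⟩
  obtain ⟨c, hc⟩ := hsurj ⟨1, h1⟩
  have h : (c : R) * v = 1 := congrArg Subtype.val hc
  have h2 := congrArg (· * w) h
  simp only [mul_assoc, hvw, mul_one, one_mul] at h2
  exact h2 ▸ c.2

section Legs

variable {k E S : Type*} [Field k] [Ring E] [Algebra k E] [Ring S] [Algebra k S]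

/-- `id ⊗ j` for an algebra homomorphism `j`. -/
noncomputable def idTensor (E : Type*) [Ring E] [Algebra k E] {X : Type*} [Ring X] [Algebra k X]
    (j : S →ₐ[k] X) : E ⊗[k] S →ₐ[k] E ⊗[k] X :=
  Algebra.TensorProduct.map (AlgHom.id k E) j

theorem idTensor_apply {X : Type*} [Ring X] [Algebra k X] (j : S →ₐ[k] X) (x : E ⊗[k] S) :
    idTensor E j x = LinearMap.lTensor E j.toLinearMap x :=
  rfl

theorem idTensor_comp {X Y : Type*} [Ring X] [Algebra k X] [Ring Y] [Algebra k Y]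
    (i : X →ₐ[k] Y) (j : S →ₐ[k] X) (x : E ⊗[k] S) :
    idTensor E (i.comp j) x = idTensor E i (idTensor E j x) := by
  simp only [idTensor_apply, ← LinearMap.comp_apply, ← LinearMap.lTensor_comp]
  rfl

/-- `x ↦ x₁₂` from `E ⊗ S` to `E ⊗ S ⊗ S`. -/
noncomputable def inc12 : E ⊗[k] S →ₐ[k] E ⊗[k] (S ⊗[k] S) :=
  idTensor E Algebra.TensorProduct.includeLeft

/-- `x ↦ x₁₃` from `E ⊗ S` to `E ⊗ S ⊗ S`. -/
noncomputable def inc13 : E ⊗[k] S →ₐ[k] E ⊗[k] (S ⊗[k] S) :=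
  idTensor E Algebra.TensorProduct.includeRight

/-- Combined with (id ⊗ δ)v = v₁₂v₁₃, this translates convolution of f and g into a product in E ⊗
S. -/
theorem lTensor_inc12_mul_inc13 (f g : S →ₗ[k] S) (x y : E ⊗[k] S) :
    LinearMap.lTensor E (LinearMap.mul' k S ∘ₗ TensorProduct.map f g) (inc12 x * inc13 y) =
      LinearMap.lTensor E f x * LinearMap.lTensor E g y := by
  induction x with
  | zero => simp
  | tmul a s =>
    induction y with
    | zero => simp
    | tmul b t => simp [inc12, inc13, idTensor]
    | add x y hx hy => simp only [map_add, mul_add, hx, hy]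
  | add x y hx hy => simp only [map_add, add_mul, hx, hy]

theorem lTensor_comm_inc13_mul_inc12 (x y : E ⊗[k] S) :
    LinearMap.lTensor E (TensorProduct.comm k S S).toLinearMap (inc13 x * inc12 y) =
      inc12 x * inc13 y := by
  induction x with
  | zero => simp
  | tmul a s =>
    induction y with
    | zero => simp
    | tmul b t => simp [inc12, inc13, idTensor]
    | add x y hx hy => simp only [map_add, mul_add, hx, hy]
  | add x y hx hy => simp only [map_add, add_mul, hx, hy]

variable {v w : E ⊗[k] S}

/-- The space of all (id ⊗ f)v is stable under right multiplication by v, since ((id ⊗ f)v)v comes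
from the convolution of f with the identity. The two maps obtained are the sources of the counit and
the antipode. -/
theorem exists_lTensor_eq_one_and_inv [Module.Finite k E] [Module.Finite k S]
    (hvw : v * w = 1) {Δ : S →ₗ[k] S ⊗[k] S}
    (hΔ : LinearMap.lTensor E Δ v = inc12 v * inc13 v) :
    (∃ f : S →ₗ[k] S, LinearMap.lTensor E f v = 1) ∧
      ∃ f : S →ₗ[k] S, LinearMap.lTensor E f v = w := by
  have h := one_mem_and_inv_mem (LinearMap.range ((LinearMap.applyₗ v : _ →ₗ[k] E ⊗[k] S) ∘ₗ
    LinearMap.lTensorHom (R := k) (N := S) (P := S) E)) hvw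
    ⟨LinearMap.id, by simp⟩ (by
      rintro _ ⟨f, rfl⟩
      refine ⟨LinearMap.mul' k S ∘ₗ TensorProduct.map f LinearMap.id ∘ₗ Δ, ?_⟩
      have h1 := lTensor_inc12_mul_inc13 f LinearMap.id v v
      rw [← hΔ, ← LinearMap.comp_apply, ← LinearMap.lTensor_comp] at h1
      simpa [LinearMap.comp_assoc] using h1)
  exact h

/-- Inverting reverses v₁₂v₁₃, so w plays for the opposite coproduct the role of v for δ. This
yields the inverse antipode. -/
theorem lTensor_comm_comul_inv (hvw : v * w = 1) (hwv : w * v = 1) (δ : S →ₐ[k] S ⊗[k] S)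
    (hδ : idTensor E δ v = inc12 v * inc13 v) :
    LinearMap.lTensor E ((TensorProduct.comm k S S).toLinearMap ∘ₗ δ.toLinearMap) w =
      inc12 w * inc13 w := by
  have h1 : idTensor E δ w = inc13 w * inc12 w := by
    have h2 : idTensor E δ w * idTensor E δ v = 1 := by rw [← map_mul, hwv, map_one]
    have h3 : inc12 v * inc13 v * (inc13 w * inc12 w) = 1 := by
      rw [mul_assoc, ← mul_assoc (inc13 v), ← map_mul, hvw, map_one, one_mul, ← map_mul, hvw,
        map_one]
    rw [hδ] at h2
    exact left_inv_eq_right_inv h2 h3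
  rw [LinearMap.lTensor_comp, LinearMap.comp_apply, ← idTensor_apply, h1,
    lTensor_comm_inc13_mul_inc12]

theorem map_lid_rTensor {X : Type*} [AddCommGroup X] [Module k X] (f : S →ₗ[k] X)
    (ω : Module.Dual k E) (x : E ⊗[k] S) :
    f (TensorProduct.lid k S (LinearMap.rTensor S ω x)) =
      TensorProduct.lid k X (LinearMap.rTensor X ω (LinearMap.lTensor E f x)) := by
  induction x with
  | zero => simp
  | tmul a s => simp
  | add x y hx hy => simp only [map_add, hx, hy]

/-- Slicing the first leg commutes with f, so (id ⊗ f)v records f on every slice; identities on S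
thereby reduce to identities about v. -/
theorem linearMap_ext_of_slices
    (hS : ∀ s, ∃ ω : Module.Dual k E, TensorProduct.lid k S (LinearMap.rTensor S ω v) = s)
    {X : Type*} [AddCommGroup X] [Module k X] {f g : S →ₗ[k] X}
    (h : LinearMap.lTensor E f v = LinearMap.lTensor E g v) : f = g := by
  ext s
  obtain ⟨ω, rfl⟩ := hS s
  rw [map_lid_rTensor, map_lid_rTensor, h]

/-- Applied to the second leg of v, both iterated coproducts give v₁₂v₁₃v₁₄. -/
theorem coassoc_of_idTensor
    (hS : ∀ s, ∃ ω : Module.Dual k E, TensorProduct.lid k S (LinearMap.rTensor S ω v) = s)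
    (δ : S →ₐ[k] S ⊗[k] S) (hδ : idTensor E δ v = inc12 v * inc13 v) (s : S) :
    TensorProduct.assoc k S S S (LinearMap.rTensor S δ.toLinearMap (δ s)) =
      LinearMap.lTensor S δ.toLinearMap (δ s) := by
  let α : (S ⊗[k] S) ⊗[k] S →ₐ[k] S ⊗[k] (S ⊗[k] S) :=
    (Algebra.TensorProduct.assoc k k k S S S).toAlgHom
  let iL : S →ₐ[k] S ⊗[k] S := Algebra.TensorProduct.includeLeft
  let iR : S →ₐ[k] S ⊗[k] S := Algebra.TensorProduct.includeRight
  let jL : S ⊗[k] S →ₐ[k] (S ⊗[k] S) ⊗[k] S := Algebra.TensorProduct.includeLeft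
  let jR : S ⊗[k] S →ₐ[k] S ⊗[k] (S ⊗[k] S) := Algebra.TensorProduct.includeRight
  let a := α.comp (Algebra.TensorProduct.map δ (AlgHom.id k S))
  let c : S ⊗[k] S →ₐ[k] S ⊗[k] (S ⊗[k] S) := Algebra.TensorProduct.map (AlgHom.id k S) δ
  have hδ' : idTensor E δ v = idTensor E iL v * idTensor E iR v := hδ
  have h1 : a.comp iL = (α.comp jL).comp δ := by
    ext x; simp [a, iL, jL]
  have h2 : (α.comp jL).comp iL = c.comp iL := by
    ext x
    simp [α, c, jL, iL]
    rfl
  have h3 : (α.comp jL).comp iR = jR.comp iL := by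
    ext x; rfl
  have h4 : a.comp iR = jR.comp iR := by
    ext x
    simp [a, α, jR, iR]
    rfl
  have h5 : c.comp iR = jR.comp δ := by
    ext x; simp [c, jR, iR]
  have key : (a.comp δ).toLinearMap = (c.comp δ).toLinearMap := by
    refine linearMap_ext_of_slices hS ?_
    rw [← idTensor_apply, ← idTensor_apply, idTensor_comp a δ, idTensor_comp c δ, hδ', map_mul, map_mul,
      ← idTensor_comp, ← idTensor_comp, ← idTensor_comp, ← idTensor_comp, h1, h4, h5,
      idTensor_comp _ δ, idTensor_comp _ δ, hδ', map_mul, map_mul, ← idTensor_comp, ← idTensor_comp,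
      ← idTensor_comp, ← idTensor_comp, h2, h3, mul_assoc]
  exact LinearMap.congr_fun key s

/-- An invertible `v ∈ E ⊗ S` with `(id ⊗ δ) v = v₁₂ v₁₃` and `(id ⊗ ε) v = 1` whose slices fill
`S` makes `S` into a Hopf algebra, the antipode being given by `(id ⊗ κ) v = v⁻¹`. -/
theorem exists_hopfData [Module.Finite k E] [Module.Finite k S] (hvw : v * w = 1)
    (hwv : w * v = 1)
    (hS : ∀ s, ∃ ω : Module.Dual k E, TensorProduct.lid k S (LinearMap.rTensor S ω v) = s)
    (δ : S →ₐ[k] S ⊗[k] S) (hδ : idTensor E δ v = inc12 v * inc13 v)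
    (ε : S →ₐ[k] k) (hε : idTensor E ((Algebra.ofId k S).comp ε) v = 1) :
    ∃ 𝓗 : HopfData k S, 𝓗.comul = δ := by
  obtain ⟨κ, hκ⟩ := (exists_lTensor_eq_one_and_inv hvw hδ).2
  have hδw := lTensor_comm_comul_inv hvw hwv δ hδ
  obtain ⟨κ', hκ'⟩ := (exists_lTensor_eq_one_and_inv hwv hδw).2
  have hκκ : κ' ∘ₗ κ = LinearMap.id := by
    refine linearMap_ext_of_slices hS ?_
    rw [LinearMap.lTensor_comp, LinearMap.comp_apply, hκ, hκ', LinearMap.lTensor_id,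
      LinearMap.id_apply]
  have hκκ' : κ ∘ₗ κ' = LinearMap.id := mul_eq_one_comm (M := Module.End k S).1 hκκ
  have hεw : idTensor E ((Algebra.ofId k S).comp ε) w = 1 := by
    have h := congrArg (idTensor E ((Algebra.ofId k S).comp ε)) hvw
    rwa [map_mul, hε, one_mul, map_one] at h
  -- The element w also separates linear maps, because w = (id ⊗ κ)v with κ bijective.
  have extw : ∀ {f g : S →ₗ[k] S}, LinearMap.lTensor E f w = LinearMap.lTensor E g w →
      ∀ s, f s = g s := by
    intro f g h s
    have h2 : f ∘ₗ κ = g ∘ₗ κ := by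
      refine linearMap_ext_of_slices hS ?_
      rw [LinearMap.lTensor_comp, LinearMap.comp_apply, hκ, h, LinearMap.lTensor_comp,
        LinearMap.comp_apply, hκ]
    have h3 := LinearMap.congr_fun h2 (κ' s)
    have h4 : κ (κ' s) = s := LinearMap.congr_fun hκκ' s
    simpa [h4] using h3
  have conv : ∀ f g h : S →ₗ[k] S, LinearMap.lTensor E f v * LinearMap.lTensor E g v =
      LinearMap.lTensor E h v → ∀ s, LinearMap.mul' k S (TensorProduct.map f g (δ s)) = h s := by
    intro f g h hfg s
    have h1 := lTensor_inc12_mul_inc13 f g v v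
    rw [← hδ, hfg, idTensor_apply, ← LinearMap.comp_apply, ← LinearMap.lTensor_comp] at h1
    exact LinearMap.congr_fun (linearMap_ext_of_slices hS h1) s
  have convw : ∀ f g h : S →ₗ[k] S, LinearMap.lTensor E f w * LinearMap.lTensor E g w =
      LinearMap.lTensor E h w →
      ∀ s, LinearMap.mul' k S (TensorProduct.map f g (TensorProduct.comm k S S (δ s))) = h s := by
    intro f g h hfg s
    have h1 := lTensor_inc12_mul_inc13 f g w w
    rw [← hδw, hfg, ← LinearMap.comp_apply, ← LinearMap.lTensor_comp] at h1
    exact extw h1 s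
  rw [idTensor_apply] at hε hεw
  set η := ((Algebra.ofId k S).comp ε).toLinearMap with hη
  have hid : ∀ x : E ⊗[k] S, LinearMap.lTensor E (LinearMap.id : S →ₗ[k] S) x = x := fun x => by
    rw [LinearMap.lTensor_id, LinearMap.id_apply]
  refine ⟨{ comul := δ
            counit := ε
            antipode := LinearEquiv.ofLinearMap κ κ' hκκ' hκκ
            coassoc := coassoc_of_idTensor hS δ hδ
            rTensor_counit := fun s => ?_
            lTensor_counit := fun s => ?_
            mul_lTensor_antipode := conv LinearMap.id κ η (by rw [hκ, hid, hvw, hε])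
            mul_rTensor_antipode := conv κ LinearMap.id η (by rw [hκ, hid, hwv, hε])
            mul_lTensor_antipode_symm := convw LinearMap.id κ' η (by rw [hκ', hid, hwv, hεw])
            mul_rTensor_antipode_symm := convw κ' LinearMap.id η (by rw [hκ', hid, hvw, hεw]) },
    rfl⟩
  · refine Eq.trans ?_ (conv η LinearMap.id LinearMap.id
      (by rw [hε, hid, one_mul]) s)
    induction δ s with
    | zero => simp
    | tmul a b => simp [hη, Algebra.smul_def, Algebra.ofId_apply]
    | add x y hx hy => simp only [map_add, hx, hy]
  · refine Eq.trans ?_ (conv LinearMap.id η LinearMap.id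
      (by rw [hε, hid, mul_one]) s)
    induction δ s with
    | zero => simp
    | tmul a b => simp [hη, Algebra.smul_def, Algebra.ofId_apply, Algebra.commutes]
    | add x y hx hy => simp only [map_add, hx, hy]

end Legs

end HopfData

namespace HopfData

theorem mem_range_lTensor_of_slices {k M N : Type*} [Field k] [AddCommGroup M] [Module k M]
    [Module.Finite k M] [AddCommGroup N] [Module k N] (P : Submodule k N) {u : M ⊗[k] N}
    (h : ∀ ω : Module.Dual k M, TensorProduct.lid k N (LinearMap.rTensor N ω u) ∈ P) :
    u ∈ LinearMap.range (LinearMap.lTensor M P.subtype) := by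
  have hflip : ∀ (ω : Module.Dual k M) (u : M ⊗[k] N),
      rslice N ω (TensorProduct.comm k M N u) =
        TensorProduct.lid k N (LinearMap.rTensor N ω u) := by
    intro ω u
    induction u with
    | zero => simp
    | tmul m n => simp
    | add x y hx hy => simp only [map_add, hx, hy]
  have hu := congrArg (TensorProduct.comm k N M)
    (sum_rslice_tmul (Module.finBasis k M) (TensorProduct.comm k M N u))
  rw [TensorProduct.comm_comm] at hu
  rw [← hu, map_sum]
  refine Submodule.sum_mem _ fun i _ => ?_
  rw [hflip]
  exact ⟨Module.finBasis k M i ⊗ₜ ⟨_, h _⟩, rfl⟩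

/-! ### Restriction to the algebra of slices. -/

section Subalgebra

variable {k E : Type*} [Field k] [Ring E] [Algebra k E] (S : Subalgebra k E)

/-- The inclusion of `S ⊗ S` in `E ⊗ E`. -/
noncomputable def valTensor : S ⊗[k] S →ₐ[k] E ⊗[k] E :=
  Algebra.TensorProduct.map S.val S.val

theorem valTensor_injective : Function.Injective (valTensor S) :=
  TensorProduct.map_injective_of_flat_flat S.val.toLinearMap S.val.toLinearMap
    Subtype.val_injective Subtype.val_injective

theorem idTensor_injective {S X : Type*} [Ring S] [Algebra k S] [Ring X] [Algebra k X]
    {j : S →ₐ[k] X} (hj : Function.Injective j) : Function.Injective (idTensor E j) :=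
  Module.Flat.lTensor_preserves_injective_linearMap j.toLinearMap hj

variable {S}

theorem idTensor_valTensor_inc12 (v : E ⊗[k] S) :
    idTensor E (valTensor S) (inc12 v) = inc12 (idTensor E S.val v) := by
  rw [inc12, inc12, ← idTensor_comp, ← idTensor_comp]
  congr 2

theorem idTensor_valTensor_inc13 (v : E ⊗[k] S) :
    idTensor E (valTensor S) (inc13 v) = inc13 (idTensor E S.val v) := by
  rw [inc13, inc13, ← idTensor_comp, ← idTensor_comp]
  congr 2

/-- A comultiplication `D` on `E` with `(id ⊗ D) u = u₁₂ u₁₃` restricts to the algebra spanned by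
the slices of `u`. -/
theorem exists_comul_restrict {v : E ⊗[k] S}
    (hS : ∀ s, ∃ ω : Module.Dual k E, TensorProduct.lid k S (LinearMap.rTensor S ω v) = s)
    (D : E →ₐ[k] E ⊗[k] E) (hD : idTensor E D (idTensor E S.val v) =
      inc12 (idTensor E S.val v) * inc13 (idTensor E S.val v)) :
    ∃ δ : S →ₐ[k] S ⊗[k] S, (∀ s, valTensor S (δ s) = D s) ∧
      idTensor E δ v = inc12 v * inc13 v := by
  -- D of a slice of u is a slice of u₁₂u₁₃, whose last two legs lie in S.
  have hmem : ∀ s : S, (D.comp S.val) s ∈ (valTensor S).range := by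
    intro s
    obtain ⟨ω, rfl⟩ := hS s
    have h1 := map_lid_rTensor (D.comp S.val).toLinearMap ω v
    rw [← idTensor_apply, idTensor_comp, hD, ← idTensor_valTensor_inc12,
      ← idTensor_valTensor_inc13, ← map_mul, idTensor_apply, ← map_lid_rTensor] at h1
    exact ⟨_, h1.symm⟩
  let e := AlgEquiv.ofInjective (valTensor S) (valTensor_injective S)
  let δ : S →ₐ[k] S ⊗[k] S := e.symm.toAlgHom.comp ((D.comp S.val).codRestrict _ hmem)
  have hδ : ∀ s, valTensor S (δ s) = D s := fun s =>
    congrArg Subtype.val (e.apply_symm_apply ⟨_, hmem s⟩)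
  refine ⟨δ, hδ, idTensor_injective (valTensor_injective S) ?_⟩
  rw [← idTensor_comp, map_mul, idTensor_valTensor_inc12, idTensor_valTensor_inc13, ← hD,
    ← idTensor_comp]
  congr 2
  ext s
  exact hδ s

end Subalgebra

/-! ### Operators on tensor powers of H as tensors of operators. -/

section TensorEnd

variable (k H : Type*) [Field k] [AddCommGroup H] [Module k H] [FiniteDimensional k H]

theorem bijective_endTensorEndAlgHom (M N : Type*) [AddCommGroup M] [Module k M]
    [FiniteDimensional k M] [AddCommGroup N] [Module k N] [FiniteDimensional k N] :
    Function.Bijective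
      (Module.endTensorEndAlgHom (R := k) (S := k) (A := k) (M := M) (N := N)) := by
  convert (homTensorHomEquiv k M N M N).bijective using 1
  funext u
  induction u with
  | zero => simp
  | tmul a b => simp [Module.endTensorEndAlgHom_apply]; rfl
  | add x y hx hy => rw [map_add, map_add, hx, hy]

/-- `End H ⊗ End H = End (H ⊗ H)` as algebras. -/
noncomputable def endEquiv :
    Module.End k H ⊗[k] Module.End k H ≃ₐ[k] Module.End k (H ⊗[k] H) :=
  AlgEquiv.ofBijective (Module.endTensorEndAlgHom (R := k) (S := k) (A := k) (M := H) (N := H))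
    (bijective_endTensorEndAlgHom k H H)

variable {k H} in
theorem endEquiv_tmul (a b : Module.End k H) :
    endEquiv k H (a ⊗ₜ b) = TensorProduct.map a b :=
  rfl

theorem endEquiv_symm_apply (T : Module.End k (H ⊗[k] H)) :
    (endEquiv k H).symm T = (homTensorHomEquiv k H H H H).symm T := by
  rw [AlgEquiv.symm_apply_eq]
  obtain ⟨u, rfl⟩ := (homTensorHomEquiv k H H H H).surjective T
  rw [LinearEquiv.symm_apply_apply]
  induction u with
  | zero => simp
  | tmul a b => simp [endEquiv_tmul]
  | add x y hx hy => simp only [map_add, hx, hy]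

/-- The embedding of `End H ⊗ (End H ⊗ End H)` in `End (H ⊗ H ⊗ H)`. -/
noncomputable def endHom3 : Module.End k H ⊗[k] (Module.End k H ⊗[k] Module.End k H) →ₐ[k]
    Module.End k ((H ⊗[k] H) ⊗[k] H) :=
  ((Module.endTensorEndAlgHom (R := k) (S := k) (A := k) (M := H ⊗[k] H) (N := H)).comp
    (Algebra.TensorProduct.map (endEquiv k H).toAlgHom (AlgHom.id k _))).comp
    (Algebra.TensorProduct.assoc k k k _ _ _).symm.toAlgHom

variable {k H} in
theorem endHom3_tmul (a b c : Module.End k H) :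
    endHom3 k H (a ⊗ₜ (b ⊗ₜ c)) = TensorProduct.map (TensorProduct.map a b) c :=
  rfl

/-- Allows the pentagon equation for operators to be pulled back to the tensor power of End H. -/
theorem endHom3_injective : Function.Injective (endHom3 k H) := by
  refine ((bijective_endTensorEndAlgHom k (H ⊗[k] H) H).1.comp ?_).comp (Algebra.TensorProduct.assoc k k k _ _ _).symm.injective
  exact Module.Flat.rTensor_preserves_injective_linearMap (endEquiv k H).toLinearMap
    (endEquiv k H).injective

variable {k H}

theorem endHom3_inc12 (u : Module.End k H ⊗[k] Module.End k H) :
    endHom3 k H (inc12 u) = LinearMap.rTensor H (endEquiv k H u) := by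
  induction u with
  | zero => simp
  | tmul a b => rfl
  | add x y hx hy => simp only [map_add, hx, hy, LinearMap.rTensor_add]

theorem endHom3_inc13 (u : Module.End k H ⊗[k] Module.End k H) :
    endHom3 k H (inc13 u) = (TensorProduct.rightComm k H H H).toLinearMap ∘ₗ
      LinearMap.rTensor H (endEquiv k H u) ∘ₗ (TensorProduct.rightComm k H H H).toLinearMap := by
  induction u with
  | zero => simp
  | tmul a b =>
    ext x y z
    simp [inc13, idTensor, endHom3_tmul, endEquiv_tmul]
  | add x y hx hy =>
    simp only [map_add, hx, hy, LinearMap.rTensor_add, LinearMap.comp_add, LinearMap.add_comp]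

theorem endHom3_one_tmul (u : Module.End k H ⊗[k] Module.End k H) :
    endHom3 k H (1 ⊗ₜ u) = (TensorProduct.assoc k H H H).symm.toLinearMap ∘ₗ
      LinearMap.lTensor H (endEquiv k H u) ∘ₗ (TensorProduct.assoc k H H H).toLinearMap := by
  induction u with
  | zero => simp
  | tmul a b =>
    ext x y z
    simp [endHom3_tmul, endEquiv_tmul]
  | add x y hx hy =>
    simp only [map_add, hx, hy, LinearMap.lTensor_add, LinearMap.comp_add, LinearMap.add_comp,
      TensorProduct.tmul_add]

end TensorEnd

/-! ### The Hopf algebra attached to the pentagon equation. -/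

section Conjugation

variable {k E : Type*} [Field k] [Ring E] [Algebra k E] {u u' : E ⊗[k] E}

/-- The homomorphism `x ↦ u (x ⊗ 1) u'` for mutually inverse `u` and `u'`. -/
noncomputable def conjHom (huu : u * u' = 1) (hu'u : u' * u = 1) : E →ₐ[k] E ⊗[k] E :=
  AlgHom.ofLinearMap (LinearMap.mulLeft k u ∘ₗ LinearMap.mulRight k u' ∘ₗ
      (Algebra.TensorProduct.includeLeft : E →ₐ[k] E ⊗[k] E).toLinearMap)
    (by
      change u * ((1 ⊗ₜ 1) * u') = 1
      rw [← Algebra.TensorProduct.one_def, one_mul, huu])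
    (fun x y => by
      change u * (((x * y) ⊗ₜ 1) * u') = u * ((x ⊗ₜ 1) * u') * (u * ((y ⊗ₜ 1) * u'))
      have h2 : (x * y) ⊗ₜ[k] (1 : E) = x ⊗ₜ 1 * y ⊗ₜ 1 := by simp
      rw [h2]
      simp only [mul_assoc]
      rw [← mul_assoc u' u, hu'u, one_mul])

theorem conjHom_apply (huu : u * u' = 1) (hu'u : u' * u = 1) (x : E) :
    conjHom huu hu'u x = u * (x ⊗ₜ 1 * u') :=
  rfl

/-- Here id ⊗ δ is conjugation of x₁₂ by u₂₃, and the pentagon rewrites u₂₃u₁₂u₂₃⁻¹ as u₁₂u₁₃. -/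
theorem idTensor_conjHom (huu : u * u' = 1) (hu'u : u' * u = 1)
    (hpent : inc12 u * inc13 u * (1 ⊗ₜ u) = (1 ⊗ₜ u) * inc12 u) :
    idTensor E (conjHom huu hu'u) u = inc12 u * inc13 u := by
  have hconj : ∀ x, idTensor E (conjHom huu hu'u) x = (1 ⊗ₜ u) * inc12 x * (1 ⊗ₜ u') := by
    intro x
    induction x with
    | zero => simp
    | tmul a b => simp [idTensor, inc12, conjHom_apply, mul_assoc]
    | add x y hx hy => simp only [map_add, mul_add, add_mul, hx, hy]
  rw [hconj, ← hpent, mul_assoc]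
  simp [huu, ← Algebra.TensorProduct.one_def]

/-- The algebra of the slices of an invertible solution of the pentagon equation is a Hopf
algebra, provided it contains `1` and `(ω ⊗ id) u ↦ ω(1)` is multiplicative. -/
theorem exists_hopfData_of_pentagon [Nontrivial E] [Module.Finite k E] (S : Subalgebra k E)
    (huu : u * u' = 1) (hu'u : u' * u = 1)
    (hpent : inc12 u * inc13 u * (1 ⊗ₜ u) = (1 ⊗ₜ u) * inc12 u)
    (hS : ∀ x, x ∈ S ↔ ∃ ω : Module.Dual k E,
      TensorProduct.lid k E (LinearMap.rTensor E ω u) = x)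
    (hmul : ∀ ω ω' : Module.Dual k E, ∃ ψ : Module.Dual k E,
      TensorProduct.lid k E (LinearMap.rTensor E ω u) *
        TensorProduct.lid k E (LinearMap.rTensor E ω' u) =
      TensorProduct.lid k E (LinearMap.rTensor E ψ u) ∧ ψ 1 = ω 1 * ω' 1) :
    ∃ 𝓗 : HopfData k S, ∀ s, valTensor S (𝓗.comul s) = u * ((s : E) ⊗ₜ 1 * u') := by
  obtain ⟨v, hv⟩ : ∃ v : E ⊗[k] S, idTensor E S.val v = u :=
    mem_range_lTensor_of_slices (Subalgebra.toSubmodule S) fun ω => (hS _).2 ⟨ω, rfl⟩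
  have hLv : ∀ ω : Module.Dual k E, TensorProduct.lid k E (LinearMap.rTensor E ω u) =
      (TensorProduct.lid k S (LinearMap.rTensor S ω v) : S) := by
    intro ω
    rw [← hv]
    exact (map_lid_rTensor S.val.toLinearMap ω v).symm
  have hinj : Function.Injective (idTensor E S.val) := idTensor_injective Subtype.val_injective
  -- The subalgebra E ⊗ S contains u and is finite-dimensional, hence contains its inverse.
  obtain ⟨w, hw⟩ : ∃ w, idTensor E S.val w = u' :=
    (one_mem_and_inv_mem (LinearMap.range (idTensor E S.val).toLinearMap) huu ⟨v, hv⟩ (by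
      rintro _ ⟨c, rfl⟩
      exact ⟨c * v, by simp [hv]⟩)).2
  have hvw : v * w = 1 := hinj (by rw [map_mul, hv, hw, huu, map_one])
  have hwv : w * v = 1 := hinj (by rw [map_mul, hv, hw, hu'u, map_one])
  have hSv : ∀ s : S, ∃ ω : Module.Dual k E,
      TensorProduct.lid k S (LinearMap.rTensor S ω v) = s := by
    intro s
    obtain ⟨ω, hω⟩ := (hS s).1 s.2
    exact ⟨ω, Subtype.ext ((hLv ω).symm.trans hω)⟩
  obtain ⟨δ, hδ, hδv⟩ := exists_comul_restrict hSv (conjHom huu hu'u) (by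
    rw [hv]; exact idTensor_conjHom huu hu'u hpent)
  obtain ⟨⟨f, hf⟩, -⟩ := exists_lTensor_eq_one_and_inv (Δ := δ.toLinearMap) hvw
    ((idTensor_apply δ v).symm.trans hδv)
  -- Since (id ⊗ f)v = 1, the rule sending the slice along ω to ω(1) is well defined; it is the
  -- counit.
  have hfω : ∀ ω : Module.Dual k E,
      f (TensorProduct.lid k S (LinearMap.rTensor S ω v)) = ω 1 • 1 := by
    intro ω
    rw [map_lid_rTensor, hf, Algebra.TensorProduct.one_def]
    simp
  obtain ⟨lam, hlam⟩ := Module.Projective.exists_dual_eq_one k (one_ne_zero : (1 : S) ≠ 0)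
  obtain ⟨ω₀, hω₀⟩ := Module.Projective.exists_dual_eq_one k (one_ne_zero : (1 : E) ≠ 0)
  let ε₀ : S →ₗ[k] k := lam ∘ₗ f
  have hε₀ : ∀ ω : Module.Dual k E,
      ε₀ (TensorProduct.lid k S (LinearMap.rTensor S ω v)) = ω 1 := by
    intro ω
    rw [LinearMap.comp_apply, hfω, map_smul, hlam, smul_eq_mul, mul_one]
  have hεmul : ∀ s t, ε₀ (s * t) = ε₀ s * ε₀ t := by
    intro s t
    obtain ⟨ω, rfl⟩ := hSv s
    obtain ⟨ω', rfl⟩ := hSv t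
    obtain ⟨ψ, hψ, hψ1⟩ := hmul ω ω'
    rw [hLv, hLv, hLv, ← Subalgebra.coe_mul] at hψ
    rw [Subtype.ext hψ, hε₀, hε₀, hε₀, hψ1]
  -- A multiplicative functional taking the value 1 somewhere, here on the slice along ω₀, is
  -- unital.
  have hone : ε₀ 1 = 1 := by
    have h := hεmul (TensorProduct.lid k S (LinearMap.rTensor S ω₀ v)) 1
    rwa [mul_one, hε₀, hω₀, one_mul, eq_comm] at h
  obtain ⟨𝓗, h𝓗⟩ := exists_hopfData hvw hwv hSv δ hδv (AlgHom.ofLinearMap ε₀ hone hεmul) (by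
    rw [idTensor_apply, ← hf]
    congr 2
    refine LinearMap.ext fun s => ?_
    obtain ⟨ω, rfl⟩ := hSv s
    rw [hfω]
    simp [hε₀, Algebra.ofId_apply, Algebra.algebraMap_eq_smul_one])
  exact ⟨𝓗, fun s => by rw [h𝓗, hδ]; rfl⟩

end Conjugation

/-! ### Coideal subalgebras of the algebra of slices. -/

section Main

variable {k H : Type*} [Field k] [AddCommGroup H] [Module k H] [FiniteDimensional k H]

/-- Freeness over coideal subalgebras for the Hopf algebra of slices of an invertible solution of
the pentagon equation. -/
theorem free_of_pentagon [Nontrivial H] {T T' : Module.End k (H ⊗[k] H)} (hTT : T * T' = 1)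
    (hT'T : T' * T = 1)
    (hpent : LinearMap.rTensor H T * ((TensorProduct.rightComm k H H H).toLinearMap ∘ₗ
        LinearMap.rTensor H T ∘ₗ (TensorProduct.rightComm k H H H).toLinearMap) *
        ((TensorProduct.assoc k H H H).symm.toLinearMap ∘ₗ LinearMap.lTensor H T ∘ₗ
          (TensorProduct.assoc k H H H).toLinearMap) =
      ((TensorProduct.assoc k H H H).symm.toLinearMap ∘ₗ LinearMap.lTensor H T ∘ₗ
          (TensorProduct.assoc k H H H).toLinearMap) * LinearMap.rTensor H T)
    (S : Subalgebra k (Module.End k H))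
    (hS : ∀ x, x ∈ S ↔ ∃ ω : Module.Dual k (Module.End k H),
      TensorProduct.lid k _ (LinearMap.rTensor (Module.End k H) ω
        ((homTensorHomEquiv k H H H H).symm T)) = x)
    (hmul : ∀ ω ω' : Module.Dual k (Module.End k H), ∃ ψ : Module.Dual k (Module.End k H),
      TensorProduct.lid k _ (LinearMap.rTensor (Module.End k H) ω
        ((homTensorHomEquiv k H H H H).symm T)) *
      TensorProduct.lid k _ (LinearMap.rTensor (Module.End k H) ω'
        ((homTensorHomEquiv k H H H H).symm T)) =
      TensorProduct.lid k _ (LinearMap.rTensor (Module.End k H) ψ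
        ((homTensorHomEquiv k H H H H).symm T)) ∧ ψ 1 = ω 1 * ω' 1)
    (B : Subalgebra k S)
    (hB : (∀ x ∈ B, T * TensorProduct.map (x : Module.End k H) 1 * T' ∈ Submodule.span k
        {R : Module.End k (H ⊗[k] H) | ∃ s : S, ∃ b ∈ B,
          R = TensorProduct.map (s : Module.End k H) (b : Module.End k H)}) ∨
      (∀ x ∈ B, T * TensorProduct.map (x : Module.End k H) 1 * T' ∈ Submodule.span k
        {R : Module.End k (H ⊗[k] H) | ∃ b ∈ B, ∃ s : S,
          R = TensorProduct.map (b : Module.End k H) (s : Module.End k H)})) :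
    Module.Free B S ∧ Module.Free B.op S := by
  simp only [← endEquiv_symm_apply] at hS hmul
  obtain ⟨𝓗, h𝓗⟩ := exists_hopfData_of_pentagon (u := (endEquiv k H).symm T)
    (u' := (endEquiv k H).symm T') S (by rw [← map_mul, hTT, map_one])
    (by rw [← map_mul, hT'T, map_one])
    (endHom3_injective k H (by
      rw [map_mul, map_mul, map_mul, endHom3_inc12, endHom3_inc13, endHom3_one_tmul,
        AlgEquiv.apply_symm_apply]
      exact hpent)) hS hmul
  let J : S ⊗[k] S →ₐ[k] Module.End k (H ⊗[k] H) := (endEquiv k H).toAlgHom.comp (valTensor S)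
  have hJ : Function.Injective J := (endEquiv k H).injective.comp (valTensor_injective S)
  have hJδ : ∀ s : S, J (𝓗.comul s) = T * TensorProduct.map (s : Module.End k H) 1 * T' := by
    intro s
    refine (congrArg (endEquiv k H) (h𝓗 s)).trans ?_
    rw [map_mul, map_mul, AlgEquiv.apply_symm_apply, AlgEquiv.apply_symm_apply, endEquiv_tmul,
      mul_assoc]
  -- Coideal conditions are stated inside End(H ⊗ H); injectivity of `J` pulls them back to S ⊗ S.
  have hmem : ∀ {x : S} {P : Submodule k (S ⊗[k] S)},
      T * TensorProduct.map (x : Module.End k H) 1 * T' ∈ P.map J.toLinearMap →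
        𝓗.comul x ∈ P := by
    rintro x P ⟨y, hy, hyx⟩
    rw [← hJδ x, AlgHom.toLinearMap_apply, hJ.eq_iff] at hyx
    exact hyx ▸ hy
  rcases hB with hB | hB
  -- A left coideal subalgebra is a right one for the opposite coproduct, with the product
  -- unchanged.
  · refine 𝓗.cop.free_and_free_op_of_rightCoideal B fun b hb =>
      comul_cop_mem (hmem (Submodule.span_le.2 ?_ (hB b hb)))
    rintro _ ⟨s, b, hb, rfl⟩
    exact ⟨_, ⟨s ⊗ₜ (⟨b, hb⟩ : B), rfl⟩, rfl⟩
  · refine 𝓗.free_and_free_op_of_rightCoideal B fun b hb =>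
      hmem (Submodule.span_le.2 ?_ (hB b hb))
    rintro _ ⟨b, hb, s, rfl⟩
    exact ⟨_, ⟨(⟨b, hb⟩ : B) ⊗ₜ s, rfl⟩, rfl⟩

end Main

end HopfData

/-! ### Application to multiplicative unitaries. -/

namespace MultiplicativeUnitary

variable {H : Type*} [NormedAddCommGroup H] [InnerProductSpace ℂ H] (V : MultiplicativeUnitary H)

theorem nontrivial_of_multiplicity_eq_one (hV : V.multiplicity = 1) : Nontrivial H := by
  by_contra hc
  rw [not_nontrivial_iff_subsingleton] at hc
  have h0 := Module.finrank_zero_of_subsingleton (R := ℂ) (M := V.fixedVectors)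
  exact one_ne_zero (hV.symm.trans h0)

variable [FiniteDimensional ℂ H]

/-- The pentagon gives V₁₃V₂₃ = V₁₂⁻¹V₂₃V₁₂, so ψ(x) = (ω ⊗ ω')(V⁻¹(1 ⊗ x)V). At x = 1 the
conjugation disappears, which makes the counit multiplicative. -/
theorem exists_L_mul_L_eq (ω ω' : Module.Dual ℂ (Module.End ℂ H)) :
    ∃ ψ, V.L ω * V.L ω' = V.L ψ ∧ ψ 1 = ω 1 * ω' 1 := by
  have h12 : MultUnitary.leg12 V.opInv * MultUnitary.leg12 V.op = 1 := by
    have h := congrArg (LinearMap.rTensor H) V.opInv_mul_op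
    rw [LinearMap.rTensor_mul] at h
    exact h.trans (LinearMap.rTensor_id H (H ⊗[ℂ] H))
  have h : MultUnitary.leg13 V.op * MultUnitary.leg23 V.op =
      MultUnitary.leg12 V.opInv * MultUnitary.leg23 V.op * MultUnitary.leg12 V.op := by
    have hp : MultUnitary.leg12 V.op * MultUnitary.leg13 V.op * MultUnitary.leg23 V.op =
      MultUnitary.leg23 V.op * MultUnitary.leg12 V.op := V.pentagon
    rw [mul_assoc, ← hp, ← mul_assoc, ← mul_assoc, h12, one_mul]
  refine ⟨_, (MultUnitary.slice_leg13_mul_leg23 ω ω' V.op V.op).symm.trans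
    ((congrArg _ h).trans (MultUnitary.slice_conj _ V.opInv V.op V.op)), ?_⟩
  have h1 : TensorProduct.mapBilinear (RingHom.id ℂ) H H H H 1 1 = 1 := TensorProduct.map_one
  have h2 : MultUnitary.slice ω (1 : Module.End ℂ (H ⊗[ℂ] H)) = ω 1 • 1 := by
    rw [← MultUnitary.slice_map, TensorProduct.map_one]
  simp only [LinearMap.comp_apply, LinearMap.mulLeft_apply, LinearMap.mulRight_apply, h1,
    one_mul, V.opInv_mul_op, h2, map_smul, smul_eq_mul]

end MultiplicativeUnitary

theorem mainTheorem8 {H : Type*} [NormedAddCommGroup H] [InnerProductSpace ℂ H]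
    [FiniteDimensional ℂ H] (V : MultiplicativeUnitary H) (hV : V.multiplicity = 1)
    (B : Subalgebra ℂ (V.S hV)) (hB : V.IsLeftCoideal hV B ∨ V.IsRightCoideal hV B) :
    Module.Free B (V.S hV) ∧ Module.Free B.op (V.S hV) := by
  have := V.nontrivial_of_multiplicity_eq_one hV
  exact HopfData.free_of_pentagon V.op_mul_opInv V.opInv_mul_op V.pentagon (V.S hV)
    (fun _ => Iff.rfl) V.exists_L_mul_L_eq B hB
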